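/- **Model.** Let $f_0,f_1:\mathfrak X\to[0,\infty)$ be probability densities with respect to a $\sigma$-finite measure $\mu$ on a measurable space $\mathfrak X$, with corresponding distributions $P_0,P_1$. Observations are received in groups whose sizes $\nu_1,\nu_2,\dots$ are i.i.d. with p.m.f. $p$ on $\{0,1,2,\dots\}$; given the group sizes the observations are i.i.d. with density $f_\theta$, $\theta\in\{0,1\}$. For $n=(n_1,\dots,n_k)$ put $p(n)=\prod_i p(n_i)$, let $X^{(n)}$ be the data of $k$ groups of sizes $n_1,\dots,n_k$, $f_\theta^{(n)}$ its joint density, and $z_n=f_1^{(n)}/f_0^{(n)}\in[0,\infty]$ (with $z_n=\infty$ if $f_0^{(n)}=0<f_1^{(n)}$, and $z_n=0$ if both vanish). A test $(\psi,\phi)$ consists of measurable functions $\psi_n,\phi_n:\mathfrak X^{n}\to[0,1]$, $n\in\{0,1,2,\dots\}^k$, $k\ge1$ (conditional probabilities to stop, respectively to reject $H_0$ after stopping); $t_n=\prod_{j<k}(1-\psi_{(n_1,\dots,n_j)})$ and $s_n=t_n\psi_n$. Let $\mathscr S_0$ be the set of tests with $\sum_{k\ge1}\sum_{n}p(n)E_0s_n=1$,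 and $$\alpha(\psi,\phi)=\sum_{k\ge1}\sum_n p(n)E_0[s_n\phi_n],\qquad \beta(\psi,\phi)=\sum_{k\ge1}\sum_n p(n)E_1[s_n(1-\phi_n)].$$ For a cost function $m\mapsto c(m)\ge 0$ of a group of size $m$, with $\bar c=\sum_m p(m)c(m)$, let $K_0(\psi)=\sum_{k\ge1}\sum_n p(n)\big(c(n_1)+\dots+c(n_k)\big)E_0s_n$. For $c,\lambda>0$ and $z\ge0$ let $g(z)=\min\{\lambda,z\}$, $\rho_0=g$, $\rho_{k}(z)=\min\{g(z),\,c+\sum_{m}p(m)E_0\rho_{k-1}(zz_m)\}$ for $k\ge1$, $\rho=\lim_k\rho_k$ and $\bar\rho(z)=\bar\rho(z;c,\lambda)=\sum_m p(m)E_0\rho(zz_m)$, where $z_m$ is the likelihood ratio of one group of size $m$. For $0<A<B$ call $(\psi,\phi)$ a *(randomized) RSPRT with bounds $A,B$* if for all $k\ge1$ and all $n$ of length $k$ with $p(n)>0$: $I_{\{z_n\in(A,B)\}}\le1-\psi_n\le I_{\{z_n\in[A,B]\}}$ holds $P_0$-a.s. on $\{t_n>0\}$, and $\phi_n=I_{\{z_n\ge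 B\}}$ holds $P_0$-a.s. and $P_1$-a.s. on $\{s_n>0\}$. **Statement.** Assume $P_0(f_1(X)>0)=1$, and let $c,\lambda>0$ satisfy $\lambda>c+\bar\rho(\lambda;c,\lambda)$. Then there exist $0<A<\lambda<B<\infty$ such that $$g(A)=c+\bar\rho(A),\qquad g(B)=c+\bar\rho(B),$$ $$g(z)<c+\bar\rho(z)\ \text{ for } 0\le z<A \text{ and for } z>B,\qquad g(z)>c+\bar\rho(z)\ \text{ for } A<z<B,$$ and such that, consequently, for every cost function with $\bar c=c$: 1. a test belongs to $\mathscr S_0$ and minimizes $K_0(\psi)+\lambda\,\alpha(\psi,\phi)+\beta(\psi,\phi)$ over $\mathscr S_0$ if and only if it is a (randomized) RSPRT with bounds $A,B$; 2. in particular, the RSPRT $\psi_n=I_{\{z_n\notin(A,B)\}}$, $\phi_n=I_{\{z_n\ge B\}}$ (for all $n$) belongs to $\mathscr S_0$ and is such a minimizer; 3. if $(\psi,\phi)$ is a (randomized) RSPRT with bounds $A,B$ and $(\psi',\phi')\in\mathscr S_0$ satisfies $\alpha(\psi',\phi')\le\alpha(\psi,\phi)$ and $\beta(\psi',\phi')\le\beta(\psi,\phi)$,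 then $K_0(\psi)\le K_0(\psi')$, with strict inequality if one of the two inequalities for the error probabilities is strict; and if $K_0(\psi')=K_0(\psi)$, then $(\psi',\phi')$ is itself a (randomized) RSPRT with bounds $A,B$. -/

import Mathlib

open MeasureTheory Set Filter Topology
open scoped ENNReal NNReal

namespace GroupSeq

/-- The random group-sequential model with stationary group sizes, for two simple hypotheses
`θ = 0, 1`: probability densities `f 0`, `f 1` with respect to a `σ`-finite measure `μ`, and the
common probability mass function `p` of the i.i.d. group sizes (groups may be empty). -/
structure Model (𝔛 : Type*) [MeasurableSpace 𝔛] where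
  μ : Measure 𝔛
  sigmaFinite : SigmaFinite μ
  f : Fin 2 → 𝔛 → ℝ≥0
  measurable_f : ∀ θ, Measurable (f θ)
  lintegral_f : ∀ θ, ∫⁻ x, (f θ x : ℝ≥0∞) ∂μ = 1
  p : PMF ℕ

/-- Data `x⁽ⁿ⁾` of `k` groups of sizes `n 0, …, n (k - 1)`. -/
abbrev Data (𝔛 : Type*) {k : ℕ} (n : Fin k → ℕ) : Type _ := (i : Fin k) → Fin (n i) → 𝔛

/-- A family of measurable functions `𝔛ⁿ → [0, 1]`, one for each tuple `n` of sizes of the groups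
observed so far (at least one group is always observed). Values are taken in `ℝ≥0∞` and are at
most `1`. Both stopping rules and decision rules are such families. -/
structure Rule (𝔛 : Type*) [MeasurableSpace 𝔛] where
  val : {k : ℕ} → (n : Fin (k + 1) → ℕ) → Data 𝔛 n → ℝ≥0∞
  measurable_val : ∀ {k : ℕ} (n : Fin (k + 1) → ℕ), Measurable (val n)
  le_one : ∀ {k : ℕ} (n : Fin (k + 1) → ℕ) (x : Data 𝔛 n), val n x ≤ 1

/-- A group-sequential test `(ψ, φ)`: `ψ` is the conditional probability to stop, `φ` the
conditional probability to reject `H₀` after stopping. -/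
structure Test (𝔛 : Type*) [MeasurableSpace 𝔛] where
  ψ : Rule 𝔛
  φ : Rule 𝔛

namespace Rule

variable {𝔛 : Type*} [MeasurableSpace 𝔛]

/-- `t_n = (1 - ψ_{(n₁)}) ⋯ (1 - ψ_{(n₁, …, n_{k-1})})`, for a tuple `n` of `k` groups
(the number of groups is written `k + 1` in the code). -/
noncomputable def t (ψ : Rule 𝔛) {k : ℕ} (n : Fin (k + 1) → ℕ) (x : Data 𝔛 n) : ℝ≥0∞ :=
  ∏ j : Fin k, (1 - ψ.val (k := j)
    (fun i => n (i.castLE (by omega))) (fun i => x (i.castLE (by omega))))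

/-- `s_n = t_n ψ_n`. -/
noncomputable def s (ψ : Rule 𝔛) {k : ℕ} (n : Fin (k + 1) → ℕ) (x : Data 𝔛 n) : ℝ≥0∞ :=
  ψ.t n x * ψ.val n x

end Rule

/-- The cost `c(n) = c(n₁) + ⋯ + c(n_k)` of `k` groups. -/
def totalCost (cost : ℕ → ℝ≥0) {k : ℕ} (n : Fin k → ℕ) : ℝ≥0 := ∑ i, cost (n i)

/-- `g(z) = min {λ, z}` (multipliers `λ₀ = λ`, `λ₁ = 1`). -/
noncomputable def g (lam : ℝ≥0) (z : ℝ≥0∞) : ℝ≥0∞ := min (lam : ℝ≥0∞) z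

namespace Model

variable {𝔛 : Type*} [MeasurableSpace 𝔛] (M : Model 𝔛)

/-- The distribution `P_θ` of one observation. -/
noncomputable def P (θ : Fin 2) : Measure 𝔛 := M.μ.withDensity (fun x => (M.f θ x : ℝ≥0∞))

/-- The distribution under `P_θ` of one group of size `m`. -/
noncomputable def groupLaw (θ : Fin 2) (m : ℕ) : Measure (Fin m → 𝔛) :=
  Measure.pi (fun _ => M.P θ)

/-- The conditional distribution under `P_θ` of the data, given the group sizes `n`. -/
noncomputable def law (θ : Fin 2) {k : ℕ} (n : Fin k → ℕ) : Measure (Data 𝔛 n) :=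
  Measure.pi (fun i => M.groupLaw θ (n i))

/-- The joint density of one group. -/
noncomputable def groupDensity (θ : Fin 2) {m : ℕ} (x : Fin m → 𝔛) : ℝ≥0∞ :=
  ∏ j, (M.f θ (x j) : ℝ≥0∞)

/-- The joint density `f_θ⁽ⁿ⁾` of the data. -/
noncomputable def density (θ : Fin 2) {k : ℕ} {n : Fin k → ℕ} (x : Data 𝔛 n) : ℝ≥0∞ :=
  ∏ i, M.groupDensity θ (x i)

/-- The likelihood ratio of one group. In `ℝ≥0∞`, `a / 0 = ∞` for `a ≠ 0` and `0 / 0 = 0`. -/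
noncomputable def groupZ {m : ℕ} (x : Fin m → 𝔛) : ℝ≥0∞ :=
  M.groupDensity 1 x / M.groupDensity 0 x

/-- The likelihood ratio `z_n` of the data. -/
noncomputable def z {k : ℕ} {n : Fin k → ℕ} (x : Data 𝔛 n) : ℝ≥0∞ :=
  M.density 1 x / M.density 0 x

/-- The probability `p(n) = p(n₁) ⋯ p(n_k)` of the group sizes `n`. -/
noncomputable def prob {k : ℕ} (n : Fin k → ℕ) : ℝ≥0∞ := ∏ i, M.p (n i)

/-- The average cost `∑ p(m) c(m)` of one group. -/
noncomputable def avgCost (cost : ℕ → ℝ≥0) : ℝ≥0∞ := ∑' m, M.p m * (cost m : ℝ≥0∞)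

/-- `P_θ(τ_ψ < ∞)`. -/
noncomputable def stopProb (θ : Fin 2) (ψ : Rule 𝔛) : ℝ≥0∞ :=
  ∑' k : ℕ, ∑' n : Fin (k + 1) → ℕ, M.prob n * ∫⁻ x, ψ.s n x ∂(M.law θ n)

/-- The class `𝒮₀` of tests that stop with `P₀`-probability one. -/
def S₀ : Set (Test 𝔛) := {T | M.stopProb 0 T.ψ = 1}

/-- The type I error probability. -/
noncomputable def α (T : Test 𝔛) : ℝ≥0∞ :=
  ∑' k : ℕ, ∑' n : Fin (k + 1) → ℕ,
    M.prob n * ∫⁻ x, T.ψ.s n x * T.φ.val n x ∂(M.law 0 n)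

/-- The type II error probability. -/
noncomputable def β (T : Test 𝔛) : ℝ≥0∞ :=
  ∑' k : ℕ, ∑' n : Fin (k + 1) → ℕ,
    M.prob n * ∫⁻ x, T.ψ.s n x * (1 - T.φ.val n x) ∂(M.law 1 n)

/-- The average total cost under `H₀`. -/
noncomputable def K₀ (cost : ℕ → ℝ≥0) (ψ : Rule 𝔛) : ℝ≥0∞ :=
  ∑' k : ℕ, ∑' n : Fin (k + 1) → ℕ,
    M.prob n * (totalCost cost n : ℝ≥0∞) * ∫⁻ x, ψ.s n x ∂(M.law 0 n)

/-- The Lagrangian `K₀(ψ) + λ α(ψ, φ) + β(ψ, φ)`. -/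
noncomputable def L (cost : ℕ → ℝ≥0) (lam : ℝ≥0) (T : Test 𝔛) : ℝ≥0∞ :=
  M.K₀ cost T.ψ + lam * M.α T + M.β T

/-- `T` minimizes the Lagrangian over `𝒮₀`. -/
def IsLagrangeOptimal (cost : ℕ → ℝ≥0) (lam : ℝ≥0) (T : Test 𝔛) : Prop :=
  T ∈ M.S₀ ∧ ∀ T' ∈ M.S₀, M.L cost lam T ≤ M.L cost lam T'

/-- `h ↦ (z ↦ ∑ₘ p(m) E₀ h(z zₘ))`, averaging over one further group. -/
noncomputable def avg (h : ℝ≥0∞ → ℝ≥0∞) (z : ℝ≥0∞) : ℝ≥0∞ :=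
  ∑' m, M.p m * ∫⁻ x, h (z * M.groupZ x) ∂(M.groupLaw 0 m)

/-- `ρ₀ = g` and `ρ_{k+1}(z) = min {g(z), c + ∑ₘ p(m) E₀ ρ_k(z zₘ)}`. -/
noncomputable def rhoSeq (c lam : ℝ≥0) : ℕ → ℝ≥0∞ → ℝ≥0∞
  | 0, z => g lam z
  | k + 1, z => min (g lam z) (c + M.avg (rhoSeq c lam k) z)

/-- `ρ = lim ρ_k`, which is the infimum since the sequence is decreasing
(see `tendsto_rhoSeq`). -/
noncomputable def rho (c lam : ℝ≥0) (z : ℝ≥0∞) : ℝ≥0∞ := ⨅ k, M.rhoSeq c lam k z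

/-- `ρ̄(z) = ∑ₘ p(m) E₀ ρ(z zₘ)`. -/
noncomputable def rhoBar (c lam : ℝ≥0) (z : ℝ≥0∞) : ℝ≥0∞ := M.avg (M.rho c lam) z

theorem rhoSeq_succ_le (c lam : ℝ≥0) (k : ℕ) :
    ∀ z, M.rhoSeq c lam (k + 1) z ≤ M.rhoSeq c lam k z := by
  induction k with
  | zero => intro z; exact min_le_left _ _
  | succ k ih =>
    intro z
    change min _ (_ + M.avg (M.rhoSeq c lam (k + 1)) z) ≤ min _ (_ + M.avg (M.rhoSeq c lam k) z)
    refine min_le_min le_rfl (add_le_add le_rfl ?_)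
    exact ENNReal.tsum_le_tsum fun m => mul_le_mul' le_rfl (lintegral_mono fun x => ih _)

theorem tendsto_rhoSeq (c lam : ℝ≥0) (z : ℝ≥0∞) :
    Tendsto (fun k => M.rhoSeq c lam k z) atTop (𝓝 (M.rho c lam z)) :=
  tendsto_atTop_iInf (antitone_nat_of_succ_le fun k => M.rhoSeq_succ_le c lam k z)

/-- `T` is a (randomized) RSPRT with bounds `A`, `B`: for all group sizes `n` of positive
probability, `I{z_n ∈ (A,B)} ≤ 1 - ψ_n ≤ I{z_n ∈ [A,B]}` holds `P₀`-almost surely where `t_n > 0`,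
and `φ_n = I{z_n ≥ B}` holds `P₀`- and `P₁`-almost surely where `s_n > 0`. -/
def IsRandomizedRSPRT (A B : ℝ≥0) (T : Test 𝔛) : Prop :=
  ∀ (k : ℕ) (n : Fin (k + 1) → ℕ), 0 < M.prob n →
    (∀ᵐ x ∂(M.law 0 n), 0 < T.ψ.t n x →
      (Ioo (A : ℝ≥0∞) B).indicator 1 (M.z x) ≤ 1 - T.ψ.val n x ∧
      1 - T.ψ.val n x ≤ (Icc (A : ℝ≥0∞) B).indicator 1 (M.z x)) ∧
    (∀ θ, ∀ᵐ x ∂(M.law θ n), 0 < T.ψ.s n x →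
      T.φ.val n x = (Ici (B : ℝ≥0∞)).indicator 1 (M.z x))

theorem measurable_z {k : ℕ} (n : Fin k → ℕ) :
    Measurable (fun x : Data 𝔛 n => M.z x) := by
  have hd : ∀ θ, Measurable (fun x : Data 𝔛 n => M.density θ x) := fun θ => by
    refine Finset.measurable_prod _ fun i _ => Finset.measurable_prod _ fun j _ => ?_
    exact measurable_coe_nnreal_ennreal.comp
      ((M.measurable_f θ).comp ((measurable_pi_apply j).comp (measurable_pi_apply i)))
  exact (hd 1).div (hd 0)

/-- The indicator of `z_n ∈ s`, as a rule. -/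
noncomputable def indicatorRule (s : Set ℝ≥0∞) (hs : MeasurableSet s) : Rule 𝔛 where
  val _ x := s.indicator 1 (M.z x)
  measurable_val n := (measurable_one.indicator hs).comp (M.measurable_z n)
  le_one _ _ := Set.indicator_le_self' (fun _ _ => zero_le_one) _

/-- The RSPRT: `ψ_n = I{z_n ∉ (A,B)}` and `φ_n = I{z_n ≥ B}`. -/
noncomputable def rsprt (A B : ℝ≥0) : Test 𝔛 where
  ψ := M.indicatorRule (Ioo (A : ℝ≥0∞) B)ᶜ measurableSet_Ioo.compl
  φ := M.indicatorRule (Ici (B : ℝ≥0∞)) measurableSet_Ici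

end Model

end GroupSeq

namespace GroupSeq

/-! ### Laws of the data and of the likelihood ratio of one group. -/

namespace Model

variable {𝔛 : Type*} [MeasurableSpace 𝔛] (M : Model 𝔛)

/-! Put H = c + ρ̄. Each ρ_k is monotone and concave, hence so is H; moreover H(0) ≥ c > 0, H(λ) <
λ, and H exceeds λ somewhere. Such a function meets min {λ, z} exactly twice: on the diagonal at A <
λ and on the level λ at B > λ (`exists_crossings`). That H exceeds λ uses P₀(f₁ > 0) = 1: then 0 <
z_m < ∞ almost surely, so ρ and ρ̄ have the same limit at infinity, and H ≤ λ throughout would make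
the optimality equation ρ = min {g, c + ρ̄} add c > 0 to a finite limit (`exists_lt_rhoBar`).

Optimality is read off an exact identity, `L_eq`: on 𝒮₀ the Lagrangian equals c + ρ̄(1) plus a sum
of nonnegative losses, from the stopping decisions and from the terminal decisions. It combines
Wald's identity `K₀_eq`, a telescoping of the optimality equation along the groups, and a change of
measure from P₁ to P₀ in which the part of P₁ singular to P₀ is kept as a loss of its own. A loss
vanishes exactly when no weight goes to the strictly worse of two options, and by the crossings this
says that the test is an RSPRT (`isRandomizedRSPRT_iff`). Vanishing stopping losses already force
termination under P₀, so the RSPRT lies in 𝒮₀ and attains the lower bound c + ρ̄(1).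

The conditional problem is the usual multiplier argument: with error probabilities no larger, a
cheaper test would have a smaller Lagrangian, and an equally cheap one is again a minimizer, hence
an RSPRT. -/

instance isProbabilityMeasure_P (θ : Fin 2) : IsProbabilityMeasure (M.P θ) :=
  ⟨by rw [P, withDensity_apply _ MeasurableSet.univ, setLIntegral_univ, M.lintegral_f θ]⟩

instance isProbabilityMeasure_groupLaw (θ : Fin 2) (m : ℕ) :
    IsProbabilityMeasure (M.groupLaw θ m) := by
  unfold groupLaw; infer_instance

instance isProbabilityMeasure_law (θ : Fin 2) {k : ℕ} (n : Fin k → ℕ) :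
    IsProbabilityMeasure (M.law θ n) := by
  unfold law; infer_instance

theorem measurable_groupDensity (θ : Fin 2) (m : ℕ) :
    Measurable (fun x : Fin m → 𝔛 => M.groupDensity θ x) :=
  Finset.measurable_prod _ fun j _ =>
    measurable_coe_nnreal_ennreal.comp ((M.measurable_f θ).comp (measurable_pi_apply j))

theorem measurable_density (θ : Fin 2) {k : ℕ} (n : Fin k → ℕ) :
    Measurable (fun x : Data 𝔛 n => M.density θ x) :=
  Finset.measurable_prod _ fun i _ =>
    (M.measurable_groupDensity θ (n i)).comp (measurable_pi_apply i)

theorem measurable_groupZ (m : ℕ) : Measurable (fun x : Fin m → 𝔛 => M.groupZ x) :=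
  (M.measurable_groupDensity 1 m).div (M.measurable_groupDensity 0 m)

theorem groupDensity_ne_top (θ : Fin 2) {m : ℕ} (x : Fin m → 𝔛) : M.groupDensity θ x ≠ ∞ :=
  ENNReal.prod_ne_top fun _ _ => ENNReal.coe_ne_top

theorem density_ne_top (θ : Fin 2) {k : ℕ} {n : Fin k → ℕ} (x : Data 𝔛 n) :
    M.density θ x ≠ ∞ :=
  ENNReal.prod_ne_top fun _ _ => M.groupDensity_ne_top θ _

/-- The distribution under `P₀` of the likelihood ratio of one group of random size. -/
noncomputable def zLaw : Measure ℝ≥0∞ :=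
  Measure.sum fun m => M.p m • (M.groupLaw 0 m).map M.groupZ

theorem avg_eq_lintegral {h : ℝ≥0∞ → ℝ≥0∞} (hh : Measurable h) (z : ℝ≥0∞) :
    M.avg h z = ∫⁻ y, h (z * y) ∂M.zLaw := by
  have hm : Measurable fun y => h (z * y) := hh.comp (measurable_const_mul z)
  simp only [avg, zLaw, lintegral_sum_measure, lintegral_smul_measure,
    lintegral_map hm (M.measurable_groupZ _), smul_eq_mul]

instance isProbabilityMeasure_zLaw : IsProbabilityMeasure M.zLaw := by
  refine ⟨?_⟩
  have h := M.avg_eq_lintegral (h := fun _ => 1) measurable_const 1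
  simp only [avg, lintegral_one, measure_univ, mul_one] at h
  rw [← h, M.p.tsum_coe]

/-- An event that excludes one value of the likelihood ratio of a group is almost sure if it
follows from an almost sure property of all observations of the group. -/
theorem ae_zLaw_ne {q : 𝔛 → Prop} (hq : ∀ᵐ x ∂(M.P 0), q x) {a : ℝ≥0∞}
    (h : ∀ (m : ℕ) (x : Fin m → 𝔛), (∀ j, q (x j)) → M.groupZ x ≠ a) :
    ∀ᵐ y ∂M.zLaw, y ≠ a := by
  have ha : MeasurableSet {y : ℝ≥0∞ | y ≠ a} := (measurableSet_singleton a).compl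
  rw [zLaw, Measure.ae_sum_iff' ha]
  refine fun m => Measure.ae_smul_measure ?_ _
  rw [ae_map_iff (M.measurable_groupZ m).aemeasurable ha]
  have hx : ∀ j : Fin m, ∀ᵐ x ∂(M.groupLaw 0 m), q (x j) := fun j =>
    (Measure.tendsto_eval_ae_ae (μ := fun _ : Fin m => M.P 0) (i := j)).eventually hq
  filter_upwards [ae_all_iff.2 hx] with x hx using h m x hx

theorem ae_zLaw_ne_zero (hf : ∀ᵐ x ∂(M.P 0), 0 < M.f 1 x) : ∀ᵐ y ∂M.zLaw, y ≠ 0 :=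
  M.ae_zLaw_ne hf fun m x hx => (ENNReal.div_pos
    (Finset.prod_ne_zero_iff.2 fun j _ => by simpa using (hx j).ne')
    (M.groupDensity_ne_top 0 x)).ne'

theorem ae_zLaw_ne_top : ∀ᵐ y ∂M.zLaw, y ≠ ∞ := by
  have hP : ∀ᵐ x ∂(M.P 0), M.f 0 x ≠ 0 := by
    rw [P, ae_withDensity_iff (M.measurable_f 0).coe_nnreal_ennreal]
    exact ae_of_all _ fun x hx => by simpa using hx
  exact M.ae_zLaw_ne hP fun m x hx => ENNReal.div_ne_top (M.groupDensity_ne_top 1 x)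
    (Finset.prod_ne_zero_iff.2 fun j _ => by simpa using hx j)

/-! ### Concavity and averaging over one further group. -/

/-- Concavity of an extended nonnegative function. -/
def IsConcave (h : ℝ≥0∞ → ℝ≥0∞) : Prop :=
  ∀ a b z w : ℝ≥0∞, a + b = 1 → a * h z + b * h w ≤ h (a * z + b * w)

theorem IsConcave.min {h h' : ℝ≥0∞ → ℝ≥0∞} (hh : IsConcave h) (hh' : IsConcave h') :
    IsConcave fun z => min (h z) (h' z) := fun a b z w hab =>
  le_min
    ((add_le_add (mul_le_mul_right (min_le_left _ _) _)
      (mul_le_mul_right (min_le_left _ _) _)).trans (hh a b z w hab))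
    ((add_le_add (mul_le_mul_right (min_le_right _ _) _)
      (mul_le_mul_right (min_le_right _ _) _)).trans (hh' a b z w hab))

theorem isConcave_const (r : ℝ≥0∞) : IsConcave fun _ => r := fun a b z w hab => by
  rw [← add_mul, hab, one_mul]

theorem IsConcave.add {h h' : ℝ≥0∞ → ℝ≥0∞} (hh : IsConcave h) (hh' : IsConcave h') :
    IsConcave fun z => h z + h' z := fun a b z w hab => by
  calc a * (h z + h' z) + b * (h w + h' w)
      = (a * h z + b * h w) + (a * h' z + b * h' w) := by ring
    _ ≤ _ := add_le_add (hh a b z w hab) (hh' a b z w hab)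

/-- For fixed y the map z ↦ z y is linear, so every integrand is concave in z, and integration
preserves this. -/
theorem IsConcave.avg {h : ℝ≥0∞ → ℝ≥0∞} (hm : Measurable h) (hh : IsConcave h) :
    IsConcave (M.avg h) := fun a b z w hab => by
  have hm' (z) : Measurable fun y => h (z * y) := hm.comp (measurable_const_mul z)
  rw [M.avg_eq_lintegral hm, M.avg_eq_lintegral hm, M.avg_eq_lintegral hm,
    ← lintegral_const_mul _ (hm' z), ← lintegral_const_mul _ (hm' w),
    ← lintegral_add_left ((hm' z).const_mul a)]
  refine lintegral_mono fun y => (hh a b (z * y) (w * y) hab).trans_eq ?_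
  rw [add_mul, mul_assoc, mul_assoc]

theorem avg_mono_left {h h' : ℝ≥0∞ → ℝ≥0∞} (hh : h ≤ h') (z : ℝ≥0∞) :
    M.avg h z ≤ M.avg h' z :=
  ENNReal.tsum_le_tsum fun _ => mul_le_mul' le_rfl (lintegral_mono fun _ => hh _)

theorem monotone_avg {h : ℝ≥0∞ → ℝ≥0∞} (hh : Monotone h) : Monotone (M.avg h) := fun _ _ hzw =>
  ENNReal.tsum_le_tsum fun _ => mul_le_mul' le_rfl (lintegral_mono fun _ =>
    hh (mul_le_mul' hzw le_rfl))

theorem avg_const (r z : ℝ≥0∞) : M.avg (fun _ => r) z = r := by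
  simp [M.avg_eq_lintegral measurable_const]

/-! ### The value function ρ, the optimality equation and the behaviour at infinity. -/

variable (c lam : ℝ≥0)

theorem monotone_g : Monotone (g lam) := fun _ _ h => min_le_min le_rfl h

theorem measurable_g : Measurable (g lam) := (monotone_g lam).measurable

theorem g_le (z : ℝ≥0∞) : g lam z ≤ lam := min_le_left _ _

theorem isConcave_g : IsConcave (g lam) :=
  (isConcave_const lam).min fun _ _ _ _ _ => le_rfl

theorem monotone_rhoSeq (k : ℕ) : Monotone (M.rhoSeq c lam k) := by
  induction k with
  | zero => exact monotone_g lam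
  | succ k ih =>
    exact fun z w h => min_le_min (monotone_g lam h) (add_le_add le_rfl (M.monotone_avg ih h))

theorem isConcave_rhoSeq (k : ℕ) : IsConcave (M.rhoSeq c lam k) := by
  induction k with
  | zero => exact isConcave_g lam
  | succ k ih =>
    exact (isConcave_g lam).min
      ((isConcave_const c).add (IsConcave.avg M (M.monotone_rhoSeq c lam k).measurable ih))

theorem monotone_rho : Monotone (M.rho c lam) := fun _ _ h =>
  iInf_mono fun k => M.monotone_rhoSeq c lam k h

theorem measurable_rho : Measurable (M.rho c lam) := (M.monotone_rho c lam).measurable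

theorem rho_le_g (z : ℝ≥0∞) : M.rho c lam z ≤ g lam z := iInf_le (fun k => M.rhoSeq c lam k z) 0

theorem rho_le (z : ℝ≥0∞) : M.rho c lam z ≤ lam := (M.rho_le_g c lam z).trans (g_le lam z)

theorem isConcave_rho : IsConcave (M.rho c lam) := fun a b z w hab =>
  le_iInf fun k => (add_le_add (mul_le_mul_right (iInf_le _ k) _)
    (mul_le_mul_right (iInf_le _ k) _)).trans (M.isConcave_rhoSeq c lam k a b z w hab)

theorem monotone_rhoBar : Monotone (M.rhoBar c lam) := M.monotone_avg (M.monotone_rho c lam)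

theorem measurable_rhoBar : Measurable (M.rhoBar c lam) := (M.monotone_rhoBar c lam).measurable

theorem rhoBar_le (z : ℝ≥0∞) : M.rhoBar c lam z ≤ lam :=
  (M.avg_mono_left (M.rho_le c lam) z).trans_eq (M.avg_const _ _)

theorem isConcave_rhoBar : IsConcave (M.rhoBar c lam) :=
  IsConcave.avg M (M.measurable_rho c lam) (M.isConcave_rho c lam)

theorem rhoSeq_le (k : ℕ) (z : ℝ≥0∞) : M.rhoSeq c lam k z ≤ lam := by
  cases k with
  | zero => exact g_le lam z
  | succ k => exact (min_le_left _ _).trans (g_le lam z)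

theorem antitone_rhoSeq : Antitone (M.rhoSeq c lam) :=
  antitone_nat_of_succ_le fun k z => M.rhoSeq_succ_le c lam k z

/-- Monotone convergence from above; it applies because everything is bounded by the constant λ and
`zLaw` is a probability measure. -/
theorem rhoBar_eq_iInf (z : ℝ≥0∞) : M.rhoBar c lam z = ⨅ k, M.avg (M.rhoSeq c lam k) z := by
  have hm (k) : Measurable fun y => M.rhoSeq c lam k (z * y) :=
    (M.monotone_rhoSeq c lam k).measurable.comp (measurable_const_mul z)
  simp_rw [rhoBar, M.avg_eq_lintegral (M.measurable_rho c lam),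
    M.avg_eq_lintegral (M.monotone_rhoSeq c lam _).measurable, rho]
  refine lintegral_iInf hm (fun i j hij y => M.antitone_rhoSeq c lam hij _) ?_
  refine ne_top_of_le_ne_top (b := (lam : ℝ≥0∞)) ENNReal.coe_ne_top ?_
  exact (lintegral_mono fun y => M.rhoSeq_le c lam 0 _).trans_eq (by simp)

/-- The optimality equation. -/
theorem rho_eq_min (z : ℝ≥0∞) : M.rho c lam z = min (g lam z) (c + M.rhoBar c lam z) := by
  rw [rhoBar_eq_iInf, ENNReal.add_iInf]
  apply le_antisymm
  · refine le_min (M.rho_le_g c lam z) (le_iInf fun k => ?_)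
    exact (iInf_le _ (k + 1)).trans (min_le_right _ _)
  · refine le_iInf fun k => ?_
    cases k with
    | zero => exact min_le_left _ _
    | succ k => exact min_le_min le_rfl (iInf_le _ k)

/-- Here positivity of the likelihood ratio enters: `ρ̄` inherits the limit of `ρ` at infinity. -/
theorem iSup_rhoBar (hf : ∀ᵐ x ∂(M.P 0), 0 < M.f 1 x) :
    ⨆ n : ℕ, M.rhoBar c lam n = ⨆ n : ℕ, M.rho c lam n := by
  have hmono (y : ℝ≥0∞) : Monotone fun n : ℕ => M.rho c lam (n * y) := fun i j hij =>
    M.monotone_rho c lam (mul_le_mul' (by exact_mod_cast hij) le_rfl)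
  simp_rw [rhoBar, M.avg_eq_lintegral (M.measurable_rho c lam)]
  rw [← lintegral_iSup (f := fun (n : ℕ) y => M.rho c lam (n * y))
    (fun n => (M.measurable_rho c lam).comp (measurable_const_mul _))
    (fun i j hij y => hmono y hij)]
  -- For 0 < y < ∞ the sequences n y and n are cofinal in each other, so a monotone function has the
  -- same supremum along both.
  have key : ∀ᵐ y ∂M.zLaw, y ≠ ∞ → ⨆ n : ℕ, M.rho c lam (n * y) = ⨆ n : ℕ, M.rho c lam n := by
    filter_upwards [M.ae_zLaw_ne_zero hf] with y hy hy'
    apply le_antisymm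
    · refine iSup_le fun n => ?_
      obtain ⟨m, hm⟩ := ENNReal.exists_nat_gt (ENNReal.mul_ne_top (ENNReal.natCast_ne_top n) hy')
      exact le_iSup_of_le m (M.monotone_rho c lam hm.le)
    · refine iSup_le fun n => ?_
      obtain ⟨m, hm⟩ := ENNReal.exists_nat_mul_gt hy (ENNReal.natCast_ne_top n)
      exact le_iSup_of_le m (M.monotone_rho c lam hm.le)
  rw [lintegral_congr_ae (g := fun _ => ⨆ n : ℕ, M.rho c lam n)
    (by filter_upwards [key, M.ae_zLaw_ne_top] with y h1 h2 using h1 h2)]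
  simp

/-- Otherwise c + ρ̄ is the smaller term in the optimality equation at all large integers, so sup ρ
≥ c + sup ρ̄ = c + sup ρ, which is impossible for a finite supremum and c > 0. -/
theorem exists_lt_rhoBar (hf : ∀ᵐ x ∂(M.P 0), 0 < M.f 1 x) (hc : 0 < c) :
    ∃ n : ℕ, (lam : ℝ≥0∞) < c + M.rhoBar c lam n := by
  by_contra! hcon
  have hle : ⨆ n : ℕ, M.rho c lam n ≤ lam := iSup_le fun n => M.rho_le c lam _
  have h2 : (c : ℝ≥0∞) + (⨆ n : ℕ, M.rho c lam n) ≤ ⨆ n : ℕ, M.rho c lam n := by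
    rw [← M.iSup_rhoBar c lam hf, ENNReal.add_iSup, M.iSup_rhoBar c lam hf]
    refine iSup_le fun n => ?_
    -- Beyond λ the function g is constantly λ, so there the minimum is bounded below by c + ρ̄(n).
    obtain ⟨m, hm⟩ := exists_nat_ge lam
    refine le_iSup_of_le (max n m) ?_
    rw [rho_eq_min]
    refine le_min (le_min (hcon n) ((hcon n).trans ?_)) (add_le_add le_rfl (M.monotone_rhoBar c lam
      (by exact_mod_cast le_max_left n m)))
    exact_mod_cast hm.trans (by exact_mod_cast le_max_right n m)
  have hne : ⨆ n : ℕ, M.rho c lam n ≠ ∞ := ne_top_of_le_ne_top ENNReal.coe_ne_top hle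
  exact (ENNReal.lt_add_right (b := c) hne (by simpa using hc.ne')).not_ge (by rwa [add_comm])

end Model

/-! ### The two crossings and the bounds A, B. -/

/-- A concave function on a half-line that is at least `r` at some point and exceeds `r` at a
larger one exceeds `r` in between. -/
theorem _root_.ConcaveOn.lt_of_le_of_lt {s : Set ℝ} {h : ℝ → ℝ} (hh : ConcaveOn ℝ s h)
    {x y w r : ℝ} (hx : x ∈ s) (hw : w ∈ s) (hxy : x < y) (hyw : y < w) (h1 : r ≤ h x)
    (h2 : r < h w) : r < h y := by
  have hpos : 0 < w - x := by linarith
  have hm := hh.2 hx hw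
    (show 0 ≤ (w - y) / (w - x) by apply div_nonneg <;> linarith)
    (show 0 ≤ (y - x) / (w - x) by apply div_nonneg <;> linarith)
    (by field_simp; ring)
  have e : ((w - y) / (w - x)) • x + ((y - x) / (w - x)) • w = y := by
    simp only [smul_eq_mul]; field_simp; ring
  rw [e] at hm
  refine lt_of_lt_of_le ?_ hm
  have hb : 0 < (y - x) / (w - x) := div_pos (by linarith) hpos
  have ha : (w - y) / (w - x) = 1 - (y - x) / (w - x) := by field_simp; ring
  simp only [smul_eq_mul]
  rw [ha]
  have ha' : 0 ≤ 1 - (y - x) / (w - x) := by rw [← ha]; apply div_nonneg <;> linarith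
  nlinarith [mul_le_mul_of_nonneg_left h1 ha', mul_lt_mul_of_pos_left h2 hb]

/-- A monotone concave function on `[0, ∞)` crosses `min {l, z}` exactly twice if it starts above
`0`, is less than `l` at `l` and exceeds `l` somewhere. -/
theorem exists_crossings {h : ℝ → ℝ} (hh : ConcaveOn ℝ (Ici 0) h) (hm : MonotoneOn h (Ici 0))
    {l N : ℝ} (hl0 : 0 < l) (h0 : 0 < h 0) (hl : h l < l) (hN0 : 0 ≤ N) (hN : l < h N) :
    ∃ A B : ℝ, 0 < A ∧ A < l ∧ l < B ∧ h A = A ∧ h B = l ∧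
      (∀ z, 0 ≤ z → z < A → z < h z) ∧ (∀ z, A < z → z ≤ l → h z < z) ∧
      (∀ z, l ≤ z → z < B → h z < l) ∧ (∀ z, B < z → l < h z) := by
  have hcont : ContinuousOn h (Ioi 0) := by
    simpa only [interior_Ici] using hh.continuousOn_interior
  have hlN : l < N := by
    by_contra! hle
    have := hm (mem_Ici.2 hN0) (mem_Ici.2 hl0.le) hle
    linarith
  -- The chord from (0, h 0) to (w, h w) starts strictly above the diagonal and ends on or above it,
  -- so it is strictly above it in between.
  have star : ∀ y w, 0 < y → y < w → w ≤ h w → y < h y := fun y w hy hyw hw => by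
    have hw0 : 0 < w := hy.trans hyw
    have hb1 : y / w < 1 := (div_lt_one hw0).2 hyw
    have key := hh.2 (mem_Ici.2 le_rfl) (mem_Ici.2 hw0.le)
      (show 0 ≤ 1 - y / w by linarith) (show 0 ≤ y / w by positivity) (by ring)
    have e : (1 - y / w) • (0 : ℝ) + (y / w) • w = y := by
      simp only [smul_eq_mul]; field_simp; ring
    rw [e] at key
    simp only [smul_eq_mul] at key
    have h1 : y / w * w ≤ y / w * h w := mul_le_mul_of_nonneg_left hw (by positivity)
    have h2 : y / w * w = y := by field_simp
    have h3 : 0 < (1 - y / w) * h 0 := mul_pos (by linarith) h0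
    linarith
  -- Monotonicity gives points arbitrarily far right, such as `max N (z + 1)`, where h > l;
  -- concavity then carries the strict inequality back to z.
  have above : ∀ y z, l ≤ h y → 0 ≤ y → y < z → l < h z := fun y z hy hy0 hyz => by
    refine hh.lt_of_le_of_lt (mem_Ici.2 hy0) (w := max N (z + 1)) (mem_Ici.2 (hN0.trans
      (le_max_left _ _))) hyz ((lt_add_one z).trans_le (le_max_right _ _)) hy ?_
    exact hN.trans_le (hm (mem_Ici.2 hN0) (mem_Ici.2 (hN0.trans (le_max_left _ _)))
      (le_max_left _ _))
  -- Concavity gives continuity only on the open half-line, so the intermediate value theorem needs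
  -- a positive left endpoint with h above the diagonal.
  obtain ⟨a, ha0, hal, hah⟩ : ∃ a, 0 < a ∧ a < l ∧ a < h a := by
    have hmin : 0 < min (h 0) l := lt_min h0 hl0
    refine ⟨min (h 0) l / 2, by positivity, ?_, ?_⟩
    · linarith [min_le_right (h 0) l]
    · have := hm (mem_Ici.2 le_rfl) (mem_Ici.2 (by positivity : 0 ≤ min (h 0) l / 2))
        (by positivity)
      linarith [min_le_left (h 0) l]
  obtain ⟨A, ⟨haA, hAl⟩, hA⟩ : ∃ A ∈ Ioo a l, h A - A = 0 := by
    have hc : ContinuousOn (fun z => h z - z) (Icc a l) :=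
      (hcont.mono fun z hz => ha0.trans_le hz.1).sub continuousOn_id
    exact intermediate_value_Ioo' hal.le hc ⟨by linarith, by linarith⟩
  obtain ⟨B, ⟨hlB, hBN⟩, hB⟩ : ∃ B ∈ Ioo l N, h B = l :=
    intermediate_value_Ioo hlN.le (hcont.mono fun z hz => hl0.trans_le hz.1) ⟨hl, hN⟩
  have hA0 : 0 < A := ha0.trans haA
  refine ⟨A, B, hA0, hAl, hlB, by linarith, hB, fun z hz hzA => ?_, fun z hAz hzl => ?_,
    fun z hlz hzB => ?_, fun z hBz => above B z hB.ge (hl0.trans hlB).le hBz⟩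
  · rcases hz.eq_or_lt with rfl | hz
    · exact h0
    · exact star z A hz hzA (by linarith)
  · by_contra! hcon
    have := star A z hA0 hAz hcon
    linarith
  · by_contra! hcon
    have := above z B hcon (hl0.le.trans hlz) hzB
    linarith

namespace Model

variable {𝔛 : Type*} [MeasurableSpace 𝔛] (M : Model 𝔛) (c lam : ℝ≥0)

theorem add_rhoBar_ne_top (z : ℝ≥0∞) : (c : ℝ≥0∞) + M.rhoBar c lam z ≠ ∞ :=
  ENNReal.add_ne_top.2 ⟨ENNReal.coe_ne_top,
    ne_top_of_le_ne_top ENNReal.coe_ne_top (M.rhoBar_le c lam z)⟩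

/-- H is finite everywhere, so the crossing argument can be run on the real function `h` and its
conclusions carried back to `ℝ≥0∞`. -/
theorem exists_bounds (hf : ∀ᵐ x ∂(M.P 0), 0 < M.f 1 x) (hc : 0 < c) (hlam : 0 < lam)
    (hcl : (c : ℝ≥0∞) + M.rhoBar c lam lam < lam) :
    ∃ A B : ℝ≥0, 0 < A ∧ A < lam ∧ lam < B ∧
      g lam A = c + M.rhoBar c lam A ∧
      g lam B = c + M.rhoBar c lam B ∧
      (∀ z : ℝ≥0, z < A ∨ B < z → g lam z < c + M.rhoBar c lam z) ∧
      (∀ z : ℝ≥0, A < z → z < B → c + M.rhoBar c lam z < g lam z) := by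
  set H : ℝ≥0∞ → ℝ≥0∞ := fun z => c + M.rhoBar c lam z with hH
  have Htop (z) : H z ≠ ∞ := M.add_rhoBar_ne_top c lam z
  have Hmono : Monotone H := fun z w hzw => add_le_add le_rfl (M.monotone_rhoBar c lam hzw)
  have Hconc : IsConcave H := (isConcave_const c).add (M.isConcave_rhoBar c lam)
  set h : ℝ → ℝ := fun z => (H (ENNReal.ofReal z)).toReal with hh
  have hconc : ConcaveOn ℝ (Ici 0) h := by
    refine ⟨convex_Ici 0, fun x hx y hy a b ha hb hab => ?_⟩
    have key := Hconc (ENNReal.ofReal a) (ENNReal.ofReal b) (ENNReal.ofReal x) (ENNReal.ofReal y)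
      (by rw [← ENNReal.ofReal_add ha hb, hab, ENNReal.ofReal_one])
    rw [← ENNReal.ofReal_mul ha, ← ENNReal.ofReal_mul hb,
      ← ENNReal.ofReal_add (mul_nonneg ha hx) (mul_nonneg hb hy)] at key
    have := ENNReal.toReal_mono (Htop _) key
    rwa [ENNReal.toReal_add (ENNReal.mul_ne_top ENNReal.ofReal_ne_top (Htop _))
      (ENNReal.mul_ne_top ENNReal.ofReal_ne_top (Htop _)), ENNReal.toReal_mul, ENNReal.toReal_mul,
      ENNReal.toReal_ofReal ha, ENNReal.toReal_ofReal hb] at this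
  have hmono : MonotoneOn h (Ici 0) := fun x _ y _ hxy =>
    ENNReal.toReal_mono (Htop _) (Hmono (ENNReal.ofReal_le_ofReal hxy))
  have hcoe (z : ℝ≥0) : H z = ENNReal.ofReal (h z) := by
    simp only [hh, ENNReal.ofReal_coe_nnreal, ENNReal.ofReal_toReal (Htop _)]
  have hgcoe (z : ℝ≥0) : g lam z = ENNReal.ofReal (min lam z) := by
    rw [g, ENNReal.ofReal_min, ENNReal.ofReal_coe_nnreal, ENNReal.ofReal_coe_nnreal]
  have hnn (z : ℝ) : 0 ≤ h z := ENNReal.toReal_nonneg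
  have hpos (z : ℝ) : 0 < h z :=
    ENNReal.toReal_pos (by simp [hH, hc.ne']) (Htop _)
  obtain ⟨N, hN⟩ := M.exists_lt_rhoBar c lam hf hc
  obtain ⟨A, B, hA0, hAl, hlB, hA, hB, h1, h2, h3, h4⟩ := exists_crossings (N := N) (l := lam)
    hconc hmono (by exact_mod_cast hlam) (hpos 0)
    (by
      have : H lam < lam := hcl
      rwa [hcoe, ← ENNReal.ofReal_coe_nnreal,
        ENNReal.ofReal_lt_ofReal_iff (by exact_mod_cast hlam)] at this)
    (Nat.cast_nonneg N)
    (by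
      have : (lam : ℝ≥0∞) < H (N : ℝ≥0) := by exact_mod_cast hN
      rwa [hcoe, ← ENNReal.ofReal_coe_nnreal, ENNReal.ofReal_lt_ofReal_iff (hpos _)] at this)
  lift A to ℝ≥0 using hA0.le
  lift B to ℝ≥0 using (hA0.le.trans hAl.le).trans hlB.le
  have hlam' : (0 : ℝ) < lam := by exact_mod_cast hlam
  refine ⟨A, B, by exact_mod_cast hA0, by exact_mod_cast hAl, by exact_mod_cast hlB, ?_, ?_,
    fun z hz => ?_, fun z hAz hzB => ?_⟩
  · change _ = H A
    rw [hcoe, hgcoe, hA, min_eq_right hAl.le]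
  · change _ = H B
    rw [hcoe, hgcoe, hB, min_eq_left hlB.le]
  · change _ < H z
    rw [hcoe, hgcoe, ENNReal.ofReal_lt_ofReal_iff (hpos _)]
    rcases hz with hz | hz
    · exact (min_le_right _ _).trans_lt (h1 z z.2 (by exact_mod_cast hz))
    · exact (min_le_left _ _).trans_lt (h4 z (by exact_mod_cast hz))
  · change H z < _
    have hAz' : (A : ℝ) < z := by exact_mod_cast hAz
    have hz0 : (0 : ℝ) < z := hA0.trans hAz'
    rw [hcoe, hgcoe, ENNReal.ofReal_lt_ofReal_iff (lt_min hlam' hz0)]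
    rcases le_total (z : ℝ) lam with hzl | hzl
    · rw [min_eq_right hzl]; exact h2 z hAz' hzl
    · rw [min_eq_left hzl]; exact h3 z hzl (by exact_mod_cast hzB)

end Model

/-! ### Finite product measures and densities. -/

theorem measurable_snoc {k : ℕ} {X : Fin (k + 1) → Type*} [∀ i, MeasurableSpace (X i)] :
    Measurable fun q : (∀ i : Fin k, X i.castSucc) × X (Fin.last k) =>
      Fin.snoc (α := X) q.1 q.2 := by
  refine measurable_pi_iff.2 fun i => ?_
  refine Fin.lastCases ?_ (fun j => ?_) i
  · simpa only [Fin.snoc_last] using measurable_snd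
  · simp only [Fin.snoc_castSucc]
    exact (measurable_pi_apply j).comp measurable_fst

/-- A finite product measure is the product of all factors but the last with the last one. -/
theorem pi_eq_map_snoc {k : ℕ} {X : Fin (k + 1) → Type*} [∀ i, MeasurableSpace (X i)]
    (ν : ∀ i, Measure (X i)) [∀ i, SigmaFinite (ν i)] :
    Measure.pi ν = ((Measure.pi fun i : Fin k => ν i.castSucc).prod (ν (Fin.last k))).map
      fun q => Fin.snoc (α := X) q.1 q.2 := by
  refine Measure.pi_eq fun s hs => ?_
  rw [Measure.map_apply measurable_snoc (MeasurableSet.univ_pi hs)]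
  have : (fun q : (∀ i : Fin k, X i.castSucc) × X (Fin.last k) => Fin.snoc (α := X) q.1 q.2) ⁻¹'
      univ.pi s = (univ.pi fun i : Fin k => s i.castSucc) ×ˢ s (Fin.last k) := by
    ext q
    simp [Set.mem_pi, Fin.forall_fin_succ']
  rw [this, Measure.prod_prod, Measure.pi_pi, Fin.prod_univ_castSucc]

theorem lintegral_pi_castSucc {k : ℕ} {X : Fin (k + 1) → Type*} [∀ i, MeasurableSpace (X i)]
    (ν : ∀ i, Measure (X i)) [∀ i, SigmaFinite (ν i)]
    {F : (∀ i : Fin k, X i.castSucc) → X (Fin.last k) → ℝ≥0∞}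
    (hF : Measurable (Function.uncurry F)) :
    ∫⁻ x, F (fun i => x i.castSucc) (x (Fin.last k)) ∂Measure.pi ν =
      ∫⁻ x, ∫⁻ y, F x y ∂ν (Fin.last k) ∂Measure.pi fun i : Fin k => ν i.castSucc := by
  have hm : Measurable fun x : ∀ i, X i => F (fun i => x i.castSucc) (x (Fin.last k)) :=
    hF.comp ((measurable_pi_iff.2 fun i => measurable_pi_apply _).prodMk (measurable_pi_apply _))
  rw [pi_eq_map_snoc, lintegral_map hm measurable_snoc]
  simp only [Fin.snoc_castSucc, Fin.snoc_last]
  exact lintegral_prod _ hF.aemeasurable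

theorem lintegral_pi_prod {k : ℕ} {X : Fin k → Type*} [∀ i, MeasurableSpace (X i)]
    (ν : ∀ i, Measure (X i)) [∀ i, SigmaFinite (ν i)] {f : ∀ i, X i → ℝ≥0∞}
    (hf : ∀ i, Measurable (f i)) :
    ∫⁻ x, ∏ i, f i (x i) ∂Measure.pi ν = ∏ i, ∫⁻ x, f i x ∂ν i := by
  induction k with
  | zero => simp
  | succ k ih =>
    have hm : Measurable fun x : ∀ i : Fin k, X i.castSucc => ∏ i, f i.castSucc (x i) :=
      Finset.measurable_prod _ fun i _ => (hf _).comp (measurable_pi_apply i)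
    simp only [Fin.prod_univ_castSucc]
    rw [lintegral_pi_castSucc ν (F := fun x y => (∏ i, f i.castSucc (x i)) * f (Fin.last k) y)
      ((hm.comp measurable_fst).mul ((hf _).comp measurable_snd))]
    simp only [lintegral_const_mul _ (hf _)]
    rw [lintegral_mul_const _ hm, ih (fun i : Fin k => ν i.castSucc) fun i => hf _]

theorem pi_withDensity {k : ℕ} {X : Fin k → Type*} [∀ i, MeasurableSpace (X i)]
    (ν : ∀ i, Measure (X i)) [∀ i, SigmaFinite (ν i)] {f : ∀ i, X i → ℝ≥0∞}
    (hf : ∀ i, Measurable (f i)) [∀ i, SigmaFinite ((ν i).withDensity (f i))] :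
    Measure.pi (fun i => (ν i).withDensity (f i)) =
      (Measure.pi ν).withDensity fun x => ∏ i, f i (x i) := by
  refine Measure.pi_eq fun s hs => ?_
  rw [withDensity_apply _ (MeasurableSet.univ_pi hs),
    ← lintegral_indicator (MeasurableSet.univ_pi hs)]
  have : (univ.pi s).indicator (fun x : ∀ i, X i => ∏ i, f i (x i)) =
      fun x => ∏ i, (s i).indicator (f i) (x i) := by
    ext x
    classical
    simp only [indicator_apply]
    rw [Finset.prod_ite_zero]
    simp
  rw [this, lintegral_pi_prod ν fun i => (hf i).indicator (hs i)]
  exact Finset.prod_congr rfl fun i _ => by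
    rw [lintegral_indicator (hs i), withDensity_apply _ (hs i)]

/-! ### Expectations over group sizes and data, and the change of measure. -/

namespace Model

variable {𝔛 : Type*} [MeasurableSpace 𝔛] (M : Model 𝔛)

/-- The expectation under `P_θ` of a function of the data of `k` groups. -/
noncomputable def expect (θ : Fin 2) {k : ℕ} (F : (n : Fin k → ℕ) → Data 𝔛 n → ℝ≥0∞) : ℝ≥0∞ :=
  ∑' n : Fin k → ℕ, M.prob n * ∫⁻ x, F n x ∂(M.law θ n)

variable {θ : Fin 2} {k : ℕ} {F F' : (n : Fin k → ℕ) → Data 𝔛 n → ℝ≥0∞}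

theorem expect_mono (h : ∀ n x, F n x ≤ F' n x) : M.expect θ F ≤ M.expect θ F' :=
  ENNReal.tsum_le_tsum fun n => mul_le_mul_right (lintegral_mono (h n)) _

theorem expect_congr (h : ∀ n x, F n x = F' n x) : M.expect θ F = M.expect θ F' := by
  have : F = F' := funext fun n => funext (h n)
  rw [this]

theorem expect_add (hF : ∀ n, Measurable (F n)) :
    M.expect θ (fun n x => F n x + F' n x) = M.expect θ F + M.expect θ F' := by
  simp only [expect, lintegral_add_left (hF _), mul_add, ENNReal.tsum_add]

theorem expect_const_mul (r : ℝ≥0∞) (hF : ∀ n, Measurable (F n)) :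
    M.expect θ (fun n x => r * F n x) = r * M.expect θ F := by
  simp only [expect, lintegral_const_mul _ (hF _), ← ENNReal.tsum_mul_left, mul_left_comm]

theorem expect_eq_zero_iff (hF : ∀ n, Measurable (F n)) :
    M.expect θ F = 0 ↔ ∀ n, 0 < M.prob n → ∀ᵐ x ∂(M.law θ n), F n x = 0 := by
  simp only [expect, ENNReal.tsum_eq_zero, mul_eq_zero, lintegral_eq_zero_iff (hF _), pos_iff_ne_zero]
  exact forall_congr' fun n => or_iff_not_imp_left

theorem lintegral_law_succ {n : Fin (k + 1) → ℕ}
    {Φ : Data 𝔛 (fun i : Fin k => n i.castSucc) → (Fin (n (Fin.last k)) → 𝔛) → ℝ≥0∞}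
    (hΦ : Measurable (Function.uncurry Φ)) :
    ∫⁻ x, Φ (fun i => x i.castSucc) (x (Fin.last k)) ∂(M.law θ n) =
      ∫⁻ x, ∫⁻ y, Φ x y ∂(M.groupLaw θ (n (Fin.last k))) ∂(M.law θ fun i => n i.castSucc) :=
  lintegral_pi_castSucc (fun i => M.groupLaw θ (n i)) hΦ

/-- Conditioning on all groups but the last. -/
theorem expect_succ
    {Φ : (n : Fin k → ℕ) → Data 𝔛 n → (m : ℕ) → (Fin m → 𝔛) → ℝ≥0∞}
    (hΦ : ∀ n m, Measurable (Function.uncurry fun x y => Φ n x m y)) :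
    M.expect θ (fun (n : Fin (k + 1) → ℕ) x => Φ (fun i => n i.castSucc) (fun i => x i.castSucc)
      (n (Fin.last k)) (x (Fin.last k))) =
    M.expect θ fun n x => ∑' m, M.p m * ∫⁻ y, Φ n x m y ∂(M.groupLaw θ m) := by
  have h1 (n : Fin (k + 1) → ℕ) := M.lintegral_law_succ (θ := θ) (n := n)
    (Φ := fun x y => Φ _ x _ y) (hΦ _ _)
  simp only [expect, h1]
  -- With the last size as a separate argument, reindexing along `Fin.snocEquiv` needs no rewriting
  -- inside the dependent type of the data.
  let H : (Fin k → ℕ) → ℕ → ℝ≥0∞ := fun n m =>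
    M.prob n * M.p m * ∫⁻ x, ∫⁻ y, Φ n x m y ∂(M.groupLaw θ m) ∂(M.law θ n)
  have h2 (n : Fin (k + 1) → ℕ) : M.prob n * ∫⁻ x, ∫⁻ y, Φ (fun i => n i.castSucc) x
      (n (Fin.last k)) y ∂(M.groupLaw θ (n (Fin.last k))) ∂(M.law θ fun i => n i.castSucc) =
      H (fun i => n i.castSucc) (n (Fin.last k)) := by
    simp only [H, prob, Fin.prod_univ_castSucc]
  rw [tsum_congr h2, ← (Fin.snocEquiv fun _ => ℕ).tsum_eq]
  have h3 (q : ℕ × (Fin k → ℕ)) : H (fun i => Fin.snocEquiv (fun _ => ℕ) q i.castSucc)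
      (Fin.snocEquiv (fun _ => ℕ) q (Fin.last k)) = H q.2 q.1 := by
    simp [Fin.snocEquiv]
  rw [tsum_congr h3, ENNReal.tsum_prod (f := fun m n => H n m), ENNReal.tsum_comm]
  refine tsum_congr fun n => ?_
  have hm (m : ℕ) : Measurable fun x => ∫⁻ y, Φ n x m y ∂(M.groupLaw θ m) :=
    (hΦ n m).lintegral_prod_right'
  rw [lintegral_tsum fun m => ((hm m).const_mul _).aemeasurable, ← ENNReal.tsum_mul_left]
  refine tsum_congr fun m => ?_
  rw [lintegral_const_mul _ (hm m), ← mul_assoc]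

theorem expect_one : M.expect θ (k := k) (fun _ _ => 1) = 1 := by
  induction k with
  | zero => simp [expect, prob]
  | succ k ih =>
    rw [M.expect_succ (Φ := fun _ _ _ _ => 1) fun _ _ => measurable_const]
    simpa [ENNReal.tsum_mul_right, M.p.tsum_coe] using ih

theorem groupLaw_eq_withDensity (m : ℕ) : M.groupLaw θ m =
    (Measure.pi fun _ : Fin m => M.μ).withDensity fun x => M.groupDensity θ x := by
  have := M.sigmaFinite
  have : SigmaFinite (M.μ.withDensity fun x => (M.f θ x : ℝ≥0∞)) :=
    inferInstanceAs (SigmaFinite (M.P θ))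
  exact pi_withDensity (fun _ : Fin m => M.μ) fun _ => (M.measurable_f θ).coe_nnreal_ennreal

/-- The measure with respect to which `density` is the density of the data. -/
noncomputable def baseLaw (n : Fin k → ℕ) : Measure (Data 𝔛 n) :=
  Measure.pi fun i => Measure.pi fun _ : Fin (n i) => M.μ

theorem law_eq_withDensity (n : Fin k → ℕ) : M.law θ n =
    (M.baseLaw n).withDensity fun x => M.density θ x := by
  have := M.sigmaFinite
  have (i : Fin k) : SigmaFinite ((Measure.pi fun _ : Fin (n i) => M.μ).withDensity
      fun x => M.groupDensity θ x) := by
    rw [← groupLaw_eq_withDensity]; infer_instance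
  simp only [law, groupLaw_eq_withDensity, baseLaw]
  exact pi_withDensity _ fun i => M.measurable_groupDensity θ (n i)

theorem lintegral_law (n : Fin k → ℕ) {f : Data 𝔛 n → ℝ≥0∞} (hf : Measurable f) :
    ∫⁻ x, f x ∂(M.law θ n) = ∫⁻ x, M.density θ x * f x ∂(M.baseLaw n) := by
  rw [law_eq_withDensity, lintegral_withDensity_eq_lintegral_mul _ (M.measurable_density θ n) hf]
  rfl

/-- The set where `P₁` is singular to `P₀`. -/
def singularSet (n : Fin k → ℕ) : Set (Data 𝔛 n) := {x | M.density 0 x = 0}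

theorem measurableSet_singularSet (n : Fin k → ℕ) : MeasurableSet (M.singularSet n) :=
  M.measurable_density 0 n (measurableSet_singleton 0)

/-- Lebesgue decomposition of the law under P₁: where f₀ ≠ 0 one has f₁ = f₀ z, and the rest of the
mass sits on f₀ = 0. -/
theorem lintegral_law_one (n : Fin k → ℕ) {f : Data 𝔛 n → ℝ≥0∞} (hf : Measurable f) :
    ∫⁻ x, f x ∂(M.law 1 n) = ∫⁻ x, M.z x * f x ∂(M.law 0 n) +
      ∫⁻ x, (M.singularSet n).indicator f x ∂(M.law 1 n) := by
  have hzf : Measurable fun x : Data 𝔛 n => M.z x * f x := (M.measurable_z n).mul hf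
  have hd : Measurable fun x : Data 𝔛 n => M.density 0 x * (M.z x * f x) :=
    (M.measurable_density 0 n).mul hzf
  rw [M.lintegral_law n hf, M.lintegral_law n hzf,
    M.lintegral_law n (hf.indicator (M.measurableSet_singularSet n)), ← lintegral_add_left hd]
  refine lintegral_congr fun x => ?_
  by_cases hx : M.density 0 x = 0
  · rw [indicator_of_mem (show x ∈ M.singularSet n from hx), hx, zero_mul, zero_add]
  · rw [indicator_of_notMem (show x ∉ M.singularSet n from hx), mul_zero, add_zero, ← mul_assoc, z,
      ENNReal.mul_div_cancel hx (M.density_ne_top 0 x)]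

theorem expect_one_eq_add (hF : ∀ n, Measurable (F n)) :
    M.expect 1 F = M.expect 0 (fun n x => M.z x * F n x) +
      M.expect 1 fun n x => (M.singularSet n).indicator (F n) x := by
  simp only [expect, M.lintegral_law_one _ (hF _), mul_add, ENNReal.tsum_add]

/-- Off the singular set P₁ is absolutely continuous with respect to P₀, so only the singular set
has to be checked under P₁ itself. -/
theorem ae_law_one_of_ae_law_zero {n : Fin k → ℕ} {q : Data 𝔛 n → Prop}
    (h0 : ∀ᵐ x ∂(M.law 0 n), q x) (h1 : ∀ᵐ x ∂(M.law 1 n), x ∈ M.singularSet n → q x) :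
    ∀ᵐ x ∂(M.law 1 n), q x := by
  have hd (θ) := M.measurable_density θ n
  rw [law_eq_withDensity, ae_withDensity_iff (hd _)] at h0 h1 ⊢
  filter_upwards [h0, h1] with x h0 h1 hx
  by_cases h : M.density 0 x = 0
  · exact h1 hx h
  · exact h0 h

/-- The convention 0 / 0 = 0 does no harm: P₁-almost surely f₁ ≠ 0. -/
theorem ae_law_one_z_eq_top (n : Fin k → ℕ) :
    ∀ᵐ x ∂(M.law 1 n), x ∈ M.singularSet n → M.z x = ∞ := by
  rw [law_eq_withDensity, ae_withDensity_iff (M.measurable_density 1 n)]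
  refine ae_of_all _ fun x hx hx0 => ?_
  rw [z, show M.density 0 x = 0 from hx0, ENNReal.div_zero hx]

theorem z_succ {n : Fin (k + 1) → ℕ} (x : Data 𝔛 n) :
    M.z x = M.z (fun i : Fin k => x i.castSucc) * M.groupZ (x (Fin.last k)) := by
  simp only [z, groupZ, density, Fin.prod_univ_castSucc, div_eq_mul_inv]
  rw [ENNReal.mul_inv (Or.inr (M.groupDensity_ne_top 0 _))
    (Or.inl (ENNReal.prod_ne_top fun _ _ => M.groupDensity_ne_top 0 _))]
  ring

end Model

/-! ### Stopping and continuation probabilities. -/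

namespace Rule

variable {𝔛 : Type*} [MeasurableSpace 𝔛] (ψ : Rule 𝔛) {k : ℕ}

theorem t_zero (n : Fin 1 → ℕ) (x : Data 𝔛 n) : ψ.t n x = 1 := by
  simp [t]

theorem t_succ (n : Fin (k + 2) → ℕ) (x : Data 𝔛 n) :
    ψ.t n x = ψ.t (fun i => n i.castSucc) (fun i => x i.castSucc) *
      (1 - ψ.val (fun i => n i.castSucc) (fun i => x i.castSucc)) :=
  Fin.prod_univ_castSucc _

theorem measurable_t (n : Fin (k + 1) → ℕ) : Measurable (ψ.t n) :=
  Finset.measurable_prod _ fun _ _ => ((ψ.measurable_val _).comp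
    (measurable_pi_iff.2 fun _ => measurable_pi_apply _)).const_sub 1

theorem measurable_s (n : Fin (k + 1) → ℕ) : Measurable (ψ.s n) :=
  (ψ.measurable_t n).mul (ψ.measurable_val n)

/-- The conditional probability to continue after the groups `n`. -/
noncomputable def u (n : Fin (k + 1) → ℕ) (x : Data 𝔛 n) : ℝ≥0∞ := ψ.t n x * (1 - ψ.val n x)

theorem measurable_u (n : Fin (k + 1) → ℕ) : Measurable (ψ.u n) :=
  (ψ.measurable_t n).mul ((ψ.measurable_val n).const_sub 1)

theorem s_add_u (n : Fin (k + 1) → ℕ) (x : Data 𝔛 n) : ψ.s n x + ψ.u n x = ψ.t n x := by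
  rw [s, u, ← mul_add, add_tsub_cancel_of_le (ψ.le_one n x), mul_one]

end Rule

namespace Model

variable {𝔛 : Type*} [MeasurableSpace 𝔛] (M : Model 𝔛) (ψ : Rule 𝔛)

/-- `P₀(τ_ψ > k)`: the test needs more than `k` groups. -/
noncomputable def contProb (k : ℕ) : ℝ≥0∞ := M.expect 0 fun (n : Fin (k + 1) → ℕ) x => ψ.t n x

theorem contProb_zero : M.contProb ψ 0 = 1 := by
  simp only [contProb, ψ.t_zero, expect_one]

/-- The factor t_n does not involve the last group, and z_n is the previous ratio times that of the
last group; integrating the last group out produces `avg`. -/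
theorem expect_t_mul_comp_z (k : ℕ) {h : ℝ≥0∞ → ℝ≥0∞} (hh : Measurable h) :
    M.expect 0 (fun (n : Fin (k + 2) → ℕ) x => ψ.t n x * h (M.z x)) =
      M.expect 0 fun (n : Fin (k + 1) → ℕ) x => ψ.u n x * M.avg h (M.z x) := by
  have hm (z : ℝ≥0∞) (m : ℕ) : Measurable fun y : Fin m → 𝔛 => h (z * M.groupZ y) :=
    hh.comp ((M.measurable_groupZ m).const_mul z)
  have key := M.expect_succ (θ := 0) (k := k + 1)
    (Φ := fun n x m y => ψ.u n x * h (M.z x * M.groupZ y)) fun n m =>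
      ((ψ.measurable_u n).comp measurable_fst).mul (hh.comp
        (((M.measurable_z n).comp measurable_fst).mul
          ((M.measurable_groupZ m).comp measurable_snd)))
  simp only [ψ.t_succ, M.z_succ (k := k + 1)]
  refine key.trans (M.expect_congr fun n x => ?_)
  simp only [lintegral_const_mul _ (hm _ _), mul_left_comm _ (ψ.u n x), ENNReal.tsum_mul_left]
  rfl

theorem contProb_succ (k : ℕ) :
    M.contProb ψ (k + 1) = M.expect 0 fun (n : Fin (k + 1) → ℕ) x => ψ.u n x := by
  have h := M.expect_t_mul_comp_z ψ k (h := fun _ => 1) measurable_const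
  simp only [M.avg_const, mul_one] at h
  exact h

theorem contProb_eq_add (k : ℕ) : M.contProb ψ k =
    M.expect 0 (fun (n : Fin (k + 1) → ℕ) x => ψ.s n x) + M.contProb ψ (k + 1) := by
  rw [contProb_succ, ← M.expect_add ψ.measurable_s]
  exact M.expect_congr fun n x => (ψ.s_add_u n x).symm

theorem sum_expect_s_add_contProb (N : ℕ) :
    ∑ k ∈ Finset.range N, M.expect 0 (fun (n : Fin (k + 1) → ℕ) x => ψ.s n x) +
      M.contProb ψ N = 1 := by
  induction N with
  | zero => simp [contProb_zero]
  | succ N ih => rw [Finset.sum_range_succ, add_assoc, ← contProb_eq_add, ih]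

/-- The partial sums of the stopping probabilities telescope to 1 - P₀(τ > N). -/
theorem stopProb_eq_one_iff :
    M.stopProb 0 ψ = 1 ↔ Tendsto (M.contProb ψ) atTop (𝓝 0) := by
  have hs : Tendsto (fun N => ∑ k ∈ Finset.range N,
      M.expect 0 (fun (n : Fin (k + 1) → ℕ) x => ψ.s n x)) atTop (𝓝 (M.stopProb 0 ψ)) :=
    ENNReal.tendsto_nat_tsum _
  have hN := M.sum_expect_s_add_contProb ψ
  constructor
  · intro h
    rw [h] at hs
    have h1 := ENNReal.Tendsto.sub (tendsto_const_nhds (x := (1 : ℝ≥0∞))) hs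
      (Or.inl ENNReal.one_ne_top)
    rw [tsub_self] at h1
    refine h1.congr fun N => ?_
    refine (ENNReal.eq_sub_of_add_eq' ENNReal.one_ne_top ?_).symm
    rw [add_comm, hN]
  · intro h
    have h1 := hs.add h
    simp only [hN, add_zero] at h1
    exact tendsto_nhds_unique h1 tendsto_const_nhds

/-! ### Wald's identity for the expected cost. -/

section Cost

/-- The expected cost of the groups observed if the `i`-th group of size `m` costs `κ i m`,
truncated after `N` steps. -/
theorem sum_expect_cost (κ : ℕ → ℕ → ℝ≥0∞) (N : ℕ) :
    ∑ k ∈ Finset.range N, M.expect 0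
        (fun (n : Fin (k + 1) → ℕ) x => (∑ i : Fin _, κ i (n i)) * ψ.s n x) +
      M.expect 0 (fun (n : Fin (N + 1) → ℕ) x => (∑ i : Fin _, κ i (n i)) * ψ.t n x) =
    ∑ k ∈ Finset.range (N + 1), (∑' m, M.p m * κ k m) * M.contProb ψ k := by
  induction N with
  | zero =>
    have key := M.expect_succ (θ := 0) (k := 0) (𝔛 := 𝔛)
      (Φ := fun _ _ m _ => κ 0 m) fun n m => measurable_const
    simp only [ψ.t_zero]
    simp only [lintegral_const, measure_univ, mul_one] at key
    simpa [expect, prob, contProb_zero] using key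
  | succ N ih =>
    have hu (n : Fin (N + 1) → ℕ) (r : ℝ≥0∞) : Measurable fun x => r * ψ.u n x :=
      (ψ.measurable_u n).const_mul r
    have key := M.expect_succ (θ := 0) (k := N + 1)
      (Φ := fun n x m _ => (∑ i : Fin _, κ i (n i) + κ (N + 1) m) * ψ.u n x) fun n m =>
        ((ψ.measurable_u n).comp measurable_fst).const_mul _
    have h1 : M.expect 0 (fun (n : Fin (N + 1 + 1) → ℕ) x => (∑ i : Fin _, κ i (n i)) * ψ.t n x) =
        M.expect 0 (fun (n : Fin (N + 1) → ℕ) x => (∑ i : Fin _, κ i (n i)) * ψ.u n x) +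
          (∑' m, M.p m * κ (N + 1) m) * M.contProb ψ (N + 1) := by
      rw [contProb_succ, ← M.expect_const_mul _ ψ.measurable_u, ← M.expect_add fun n => hu n _]
      simp only [Fin.sum_univ_castSucc (n := N + 1), ψ.t_succ]
      refine key.trans (M.expect_congr fun n x => ?_)
      simp only [lintegral_const, measure_univ, mul_one, add_mul, mul_add, ENNReal.tsum_add,
        ENNReal.tsum_mul_right, M.p.tsum_coe, one_mul, ← mul_assoc]
    have h2 : M.expect 0 (fun (n : Fin (N + 1) → ℕ) x => (∑ i : Fin _, κ i (n i)) * ψ.t n x) =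
        M.expect 0 (fun (n : Fin (N + 1) → ℕ) x => (∑ i : Fin _, κ i (n i)) * ψ.s n x) +
        M.expect 0 (fun (n : Fin (N + 1) → ℕ) x => (∑ i : Fin _, κ i (n i)) * ψ.u n x) := by
      rw [← M.expect_add fun n => (ψ.measurable_s n).const_mul _]
      exact M.expect_congr fun n x => by rw [← mul_add, ψ.s_add_u]
    rw [Finset.sum_range_succ _ (N + 1), ← ih, h1, h2, Finset.sum_range_succ]
    ring

variable (cost : ℕ → ℝ≥0)

theorem K₀_eq_tsum : M.K₀ cost ψ = ∑' k, M.expect 0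
    fun (n : Fin (k + 1) → ℕ) x => (∑ i, (cost (n i) : ℝ≥0∞)) * ψ.s n x := by
  simp only [K₀, expect, totalCost, lintegral_const_mul _ (ψ.measurable_s _), mul_assoc,
    ENNReal.ofNNReal_finsetSum]

theorem K₀_le : M.K₀ cost ψ ≤ M.avgCost cost * ∑' k, M.contProb ψ k := by
  rw [K₀_eq_tsum, ENNReal.tsum_eq_iSup_nat]
  refine iSup_le fun N => ?_
  refine (self_le_add_right _ _).trans ((M.sum_expect_cost ψ (fun _ m => cost m) N).trans_le ?_)
  rw [← Finset.mul_sum]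
  exact mul_le_mul_right (ENNReal.sum_le_tsum _) _

/-- The lower half of Wald's identity. Without truncation the cost carried by tests still running
after N steps need not be controllable; charging only the first `J` groups, at most `b` each, bounds
it by J b P₀(τ > N) → 0. -/
theorem truncated_cost_le (hψ : Tendsto (M.contProb ψ) atTop (𝓝 0)) (J b : ℕ) :
    (∑' m, M.p m * min (cost m : ℝ≥0∞) b) * ∑ k ∈ Finset.range J, M.contProb ψ k ≤
      M.K₀ cost ψ := by
  let κ : ℕ → ℕ → ℝ≥0∞ := fun i m => if i < J then min (cost m : ℝ≥0∞) b else 0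
  have hκ (k : ℕ) (n : Fin (k + 1) → ℕ) : ∑ i : Fin _, κ i (n i) ≤ ∑ i, (cost (n i) : ℝ≥0∞) :=
    Finset.sum_le_sum fun i _ => by
      simp only [κ]; split_ifs
      · exact min_le_left _ _
      · exact zero_le
  have hκ' (k : ℕ) (n : Fin (k + 1) → ℕ) : ∑ i : Fin _, κ i (n i) ≤ J * b := by
    calc ∑ i : Fin _, κ i (n i) ≤ ∑ i : Fin (k + 1), if (i : ℕ) < J then (b : ℝ≥0∞) else 0 :=
          Finset.sum_le_sum fun i _ => by
            simp only [κ]; split_ifs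
            · exact min_le_right _ _
            · exact le_rfl
      _ = ∑ i ∈ Finset.range (k + 1), if i < J then (b : ℝ≥0∞) else 0 :=
          (Finset.sum_range fun i => if i < J then (b : ℝ≥0∞) else 0).symm
      _ = ∑ i ∈ (Finset.range (k + 1)).filter (· < J), (b : ℝ≥0∞) :=
          (Finset.sum_filter _ _).symm
      _ ≤ ∑ i ∈ Finset.range J, (b : ℝ≥0∞) := Finset.sum_le_sum_of_subset fun i hi => by
          simpa using (Finset.mem_filter.1 hi).2
      _ = J * b := by simp
  have hbound (N : ℕ) (hN : J ≤ N + 1) :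
      (∑' m, M.p m * min (cost m : ℝ≥0∞) b) * ∑ k ∈ Finset.range J, M.contProb ψ k ≤
        M.K₀ cost ψ + J * b * M.contProb ψ N := by
    calc _ = ∑ k ∈ Finset.range J, (∑' m, M.p m * κ k m) * M.contProb ψ k := by
          rw [Finset.mul_sum]
          refine Finset.sum_congr rfl fun k hk => ?_
          simp only [κ, if_pos (Finset.mem_range.1 hk)]
      _ ≤ ∑ k ∈ Finset.range (N + 1), (∑' m, M.p m * κ k m) * M.contProb ψ k :=
          Finset.sum_le_sum_of_subset (Finset.range_mono hN)
      _ ≤ _ := by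
          rw [← sum_expect_cost, K₀_eq_tsum]
          refine add_le_add ((Finset.sum_le_sum fun k _ => M.expect_mono fun n x =>
            mul_le_mul_left (hκ k n) _).trans (ENNReal.sum_le_tsum _)) ?_
          rw [contProb, ← M.expect_const_mul _ ψ.measurable_t]
          exact M.expect_mono fun n x => mul_le_mul_left (hκ' N n) _
  have hlim : Tendsto (fun N => M.K₀ cost ψ + J * b * M.contProb ψ N) atTop
      (𝓝 (M.K₀ cost ψ)) := by
    have := (ENNReal.Tendsto.const_mul hψ (a := (J * b : ℝ≥0∞)) (Or.inr (ENNReal.mul_ne_top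
      (ENNReal.natCast_ne_top J) (ENNReal.natCast_ne_top b)))).const_add (M.K₀ cost ψ)
    simpa using this
  refine ge_of_tendsto hlim ?_
  filter_upwards [eventually_ge_atTop J] with N hN using hbound N (by omega)

theorem avgCost_eq_iSup :
    M.avgCost cost = ⨆ b : ℕ, ∑' m, M.p m * min (cost m : ℝ≥0∞) b := by
  have hb (m : ℕ) : (M.p m * cost m : ℝ≥0∞) = ⨆ b : ℕ, M.p m * min (cost m : ℝ≥0∞) b := by
    refine le_antisymm ?_ (iSup_le fun b => mul_le_mul_right (min_le_left _ _) _)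
    obtain ⟨b, hb⟩ := exists_nat_ge (cost m)
    refine le_iSup_of_le b ?_
    rw [min_eq_left (by exact_mod_cast hb)]
  have hmono (m : ℕ) : Monotone fun b : ℕ => M.p m * min (cost m : ℝ≥0∞) b := fun i j hij =>
    mul_le_mul_right (min_le_min le_rfl (by exact_mod_cast hij)) _
  simp only [avgCost, hb, ENNReal.tsum_eq_iSup_sum, ENNReal.finsetSum_iSup_of_monotone hmono]
  exact iSup_comm

/-- Wald's identity. -/
theorem K₀_eq (hψ : Tendsto (M.contProb ψ) atTop (𝓝 0)) :
    M.K₀ cost ψ = M.avgCost cost * ∑' k, M.contProb ψ k := by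
  refine le_antisymm (M.K₀_le ψ cost) ?_
  rw [avgCost_eq_iSup, ENNReal.tsum_eq_iSup_nat, ENNReal.iSup_mul]
  refine iSup_le fun b => ?_
  rw [ENNReal.mul_iSup]
  exact iSup_le fun J => M.truncated_cost_le ψ cost hψ J b

end Cost

end Model

/-! ### Excess losses and the exact formula for the Lagrangian. -/

/-- The source of all uniqueness below: any weight on the strictly worse option `b` raises the mean.
The better value `a` is finite, so it can be cancelled, while `b` may be ∞. -/
theorem weighted_mean_le_iff {a b y w : ℝ≥0∞} (hyw : y + w = 1) (hab : a < b) :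
    y * b + w * a ≤ a ↔ y = 0 := by
  have hw : w ≠ ∞ := ne_top_of_le_ne_top ENNReal.one_ne_top (hyw ▸ le_add_self)
  have hy : y ≠ ∞ := ne_top_of_le_ne_top ENNReal.one_ne_top (hyw ▸ le_self_add)
  constructor
  · intro h
    have h1 : y * b + w * a ≤ y * a + w * a := by rwa [← add_mul, hyw, one_mul]
    have h2 := (ENNReal.add_le_add_iff_right (ENNReal.mul_ne_top hw hab.ne_top)).1 h1
    by_contra hy0
    exact hab.not_ge ((ENNReal.mul_le_mul_iff_right hy0 hy).1 h2)
  · rintro rfl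
    rw [zero_add] at hyw
    simp [hyw]

theorem eq_zero_of_one_le_one_sub {y : ℝ≥0∞} (hy : y ≤ 1) (h : 1 ≤ 1 - y) : y = 0 := by
  have hsum := add_tsub_cancel_of_le hy
  rw [le_antisymm tsub_le_self h] at hsum
  exact (ENNReal.add_left_inj ENNReal.one_ne_top).1 (hsum.trans (zero_add 1).symm)

theorem le_weighted_mean {r a b y : ℝ≥0∞} (hy : y ≤ 1) (ha : r ≤ a) (hb : r ≤ b) :
    r ≤ y * a + (1 - y) * b := by
  calc r = y * r + (1 - y) * r := by rw [← add_mul, add_tsub_cancel_of_le hy, one_mul]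
    _ ≤ _ := add_le_add (mul_le_mul_right ha _) (mul_le_mul_right hb _)

/-- The excess loss of rejecting `H₀` with probability `y` at the likelihood ratio `z`. -/
noncomputable def decisionDefect (lam : ℝ≥0) (y z : ℝ≥0∞) : ℝ≥0∞ :=
  y * lam + (1 - y) * z - g lam z

theorem g_add_decisionDefect (lam : ℝ≥0) {y z : ℝ≥0∞} (hy : y ≤ 1) :
    g lam z + decisionDefect lam y z = y * lam + (1 - y) * z :=
  add_tsub_cancel_of_le (le_weighted_mean hy (min_le_left _ _) (min_le_right _ _))

theorem measurable_decisionDefect (lam : ℝ≥0) {Ω : Type*} [MeasurableSpace Ω] {y z : Ω → ℝ≥0∞}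
    (hy : Measurable y) (hz : Measurable z) :
    Measurable fun x => decisionDefect lam (y x) (z x) :=
  ((hy.mul_const _).add ((hy.const_sub 1).mul hz)).sub ((Model.measurable_g lam).comp hz)

namespace Model

variable {𝔛 : Type*} [MeasurableSpace 𝔛] (M : Model 𝔛) (c lam : ℝ≥0)

/-- The excess loss of stopping with probability `y` at the likelihood ratio `z`, relative to the
better of stopping and continuing. -/
noncomputable def stopDefect (y z : ℝ≥0∞) : ℝ≥0∞ :=
  y * g lam z + (1 - y) * (c + M.rhoBar c lam z) - M.rho c lam z

theorem rho_add_stopDefect {y z : ℝ≥0∞} (hy : y ≤ 1) :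
    M.rho c lam z + M.stopDefect c lam y z =
      y * g lam z + (1 - y) * (c + M.rhoBar c lam z) := by
  refine add_tsub_cancel_of_le (le_weighted_mean hy ?_ ?_) <;> rw [rho_eq_min]
  exacts [min_le_left _ _, min_le_right _ _]

theorem measurable_stopDefect {Ω : Type*} [MeasurableSpace Ω] {y z : Ω → ℝ≥0∞}
    (hy : Measurable y) (hz : Measurable z) :
    Measurable fun x => M.stopDefect c lam (y x) (z x) :=
  ((hy.mul ((measurable_g lam).comp hz)).add ((hy.const_sub 1).mul
    (((M.measurable_rhoBar c lam).comp hz).const_add _))).sub ((M.measurable_rho c lam).comp hz)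

/-- The expected excess loss from the decision whether to stop after `k + 1` groups. -/
noncomputable def stopLoss (ψ : Rule 𝔛) (k : ℕ) : ℝ≥0∞ :=
  M.expect 0 fun (n : Fin (k + 1) → ℕ) x => ψ.t n x * M.stopDefect c lam (ψ.val n x) (M.z x)

/-- The expected excess loss from the terminal decision after `k + 1` groups. -/
noncomputable def decisionLoss (T : Test 𝔛) (k : ℕ) : ℝ≥0∞ :=
  M.expect 0 (fun (n : Fin (k + 1) → ℕ) x =>
    T.ψ.s n x * decisionDefect lam (T.φ.val n x) (M.z x)) +
  M.expect 1 fun (n : Fin (k + 1) → ℕ) x =>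
    (M.singularSet n).indicator (fun x => T.ψ.s n x * (1 - T.φ.val n x)) x

/-- One step of backward induction as an equality: weight the identity for `stopDefect` by t_n, and
turn ρ̄ into ρ one group later. -/
theorem expect_t_mul_rho_add_stopLoss (ψ : Rule 𝔛) (k : ℕ) :
    M.expect 0 (fun (n : Fin (k + 1) → ℕ) x => ψ.t n x * M.rho c lam (M.z x)) +
      M.stopLoss c lam ψ k =
    M.expect 0 (fun (n : Fin (k + 1) → ℕ) x => ψ.s n x * g lam (M.z x)) +
      c * M.contProb ψ (k + 1) +
      M.expect 0 (fun (n : Fin (k + 2) → ℕ) x => ψ.t n x * M.rho c lam (M.z x)) := by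
  have h1 (n : Fin (k + 1) → ℕ) :
      Measurable fun x => ψ.t n x * M.rho c lam (M.z x) :=
    (ψ.measurable_t n).mul ((M.measurable_rho c lam).comp (M.measurable_z n))
  have h2 (n : Fin (k + 1) → ℕ) : Measurable fun x => ψ.s n x * g lam (M.z x) :=
    (ψ.measurable_s n).mul ((measurable_g lam).comp (M.measurable_z n))
  have h3 (n : Fin (k + 1) → ℕ) : Measurable fun x => c * ψ.u n x :=
    (ψ.measurable_u n).const_mul _
  have h4 (n : Fin (k + 1) → ℕ) : Measurable fun x => ψ.s n x * g lam (M.z x) + c * ψ.u n x :=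
    (h2 n).add (h3 n)
  rw [M.expect_t_mul_comp_z ψ k (M.measurable_rho c lam), contProb_succ,
    ← M.expect_const_mul _ ψ.measurable_u, ← M.expect_add h2,
    ← M.expect_add h4, stopLoss, ← M.expect_add h1]
  refine M.expect_congr fun n x => ?_
  rw [← mul_add, M.rho_add_stopDefect c lam (ψ.le_one n x), Rule.s, Rule.u, rhoBar]
  ring

/-- The first group is always observed, and the empty data have likelihood ratio 1. -/
theorem expect_t_mul_rho_zero (ψ : Rule 𝔛) :
    M.expect 0 (fun (n : Fin 1 → ℕ) x => ψ.t n x * M.rho c lam (M.z x)) = M.rhoBar c lam 1 := by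
  have key := M.expect_succ (θ := 0) (k := 0)
    (Φ := fun n x m y => M.rho c lam (M.z x * M.groupZ y)) fun n m =>
      (M.measurable_rho c lam).comp (((M.measurable_z n).comp measurable_fst).mul
        ((M.measurable_groupZ m).comp measurable_snd))
  simp only [ψ.t_zero, one_mul, M.z_succ (k := 0)]
  refine key.trans ?_
  simp [expect, prob, z, density, rhoBar, avg]

theorem rhoBar_add_sum_stopLoss (ψ : Rule 𝔛) (N : ℕ) :
    M.rhoBar c lam 1 + ∑ k ∈ Finset.range N, M.stopLoss c lam ψ k =
      ∑ k ∈ Finset.range N, (M.expect 0 (fun (n : Fin (k + 1) → ℕ) x => ψ.s n x * g lam (M.z x)) +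
        c * M.contProb ψ (k + 1)) +
      M.expect 0 (fun (n : Fin (N + 1) → ℕ) x => ψ.t n x * M.rho c lam (M.z x)) := by
  induction N with
  | zero => simpa using (M.expect_t_mul_rho_zero c lam ψ).symm
  | succ N ih =>
    rw [Finset.sum_range_succ, ← add_assoc, ih, add_assoc, expect_t_mul_rho_add_stopLoss,
      Finset.sum_range_succ]
    ring

/-- The remainder of the telescoped sum is at most λ P₀(τ > N), which tends to 0. -/
theorem rhoBar_add_tsum_stopLoss {ψ : Rule 𝔛} (hψ : Tendsto (M.contProb ψ) atTop (𝓝 0)) :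
    M.rhoBar c lam 1 + ∑' k, M.stopLoss c lam ψ k =
      ∑' k, (M.expect 0 (fun (n : Fin (k + 1) → ℕ) x => ψ.s n x * g lam (M.z x)) +
        c * M.contProb ψ (k + 1)) := by
  have h0 : Tendsto (fun N => M.expect 0
      (fun (n : Fin (N + 1) → ℕ) x => ψ.t n x * M.rho c lam (M.z x))) atTop (𝓝 0) := by
    have h1 := ENNReal.Tendsto.const_mul hψ (a := (lam : ℝ≥0∞)) (Or.inr ENNReal.coe_ne_top)
    rw [mul_zero] at h1
    refine tendsto_of_tendsto_of_tendsto_of_le_of_le tendsto_const_nhds h1 (fun _ => zero_le)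
      fun N => ?_
    dsimp only
    rw [contProb, ← M.expect_const_mul _ ψ.measurable_t]
    exact M.expect_mono fun n x => by
      rw [mul_comm]; exact mul_le_mul_left (M.rho_le c lam _) _
  have h2 := (ENNReal.tendsto_nat_tsum (M.stopLoss c lam ψ)).const_add (M.rhoBar c lam 1)
  have h3 := (ENNReal.tendsto_nat_tsum fun k => M.expect 0
    (fun (n : Fin (k + 1) → ℕ) x => ψ.s n x * g lam (M.z x)) + c * M.contProb ψ (k + 1)).add h0
  simp only [rhoBar_add_sum_stopLoss, add_zero] at h2 h3
  exact tendsto_nhds_unique h2 h3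

/-- After the change of measure the integrand is s_n times λ φ_n + (1 - φ_n) z_n, that is, g plus
the decision defect; acceptance on the singular set is a pure loss. -/
theorem expect_errors (T : Test 𝔛) (k : ℕ) :
    lam * M.expect 0 (fun (n : Fin (k + 1) → ℕ) x => T.ψ.s n x * T.φ.val n x) +
      M.expect 1 (fun (n : Fin (k + 1) → ℕ) x => T.ψ.s n x * (1 - T.φ.val n x)) =
    M.expect 0 (fun (n : Fin (k + 1) → ℕ) x => T.ψ.s n x * g lam (M.z x)) +
      M.decisionLoss lam T k := by
  have h1 (n : Fin (k + 1) → ℕ) : Measurable fun x => T.ψ.s n x * T.φ.val n x :=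
    (T.ψ.measurable_s n).mul (T.φ.measurable_val n)
  have h2 (n : Fin (k + 1) → ℕ) : Measurable fun x => T.ψ.s n x * (1 - T.φ.val n x) :=
    (T.ψ.measurable_s n).mul ((T.φ.measurable_val n).const_sub 1)
  have h3 (n : Fin (k + 1) → ℕ) : Measurable fun x => T.ψ.s n x * g lam (M.z x) :=
    (T.ψ.measurable_s n).mul ((measurable_g lam).comp (M.measurable_z n))
  rw [M.expect_one_eq_add h2, ← M.expect_const_mul _ h1, ← add_assoc,
    ← M.expect_add fun n => (h1 n).const_mul _, decisionLoss, ← add_assoc, ← M.expect_add h3]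
  congr 1
  refine M.expect_congr fun n x => ?_
  rw [← mul_add, g_add_decisionDefect lam (T.φ.le_one n x)]
  ring

/-- The Lagrangian exceeds its minimum by the losses from suboptimal decisions. -/
theorem L_eq {cost : ℕ → ℝ≥0} (hcost : M.avgCost cost = c) {T : Test 𝔛} (hT : T ∈ M.S₀) :
    M.L cost lam T = c + M.rhoBar c lam 1 +
      (∑' k, M.stopLoss c lam T.ψ k + ∑' k, M.decisionLoss lam T k) := by
  have hψ := (M.stopProb_eq_one_iff T.ψ).1 hT
  have h1 : lam * M.α T + M.β T =
      ∑' k, M.expect 0 (fun (n : Fin (k + 1) → ℕ) x => T.ψ.s n x * g lam (M.z x)) +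
        ∑' k, M.decisionLoss lam T k := by
    rw [← ENNReal.tsum_add]
    simp only [← expect_errors]
    rw [ENNReal.tsum_add, ENNReal.tsum_mul_left]
    rfl
  -- The compulsory first group accounts for the isolated summand c.
  have h2 : ∑' k, M.contProb T.ψ k = 1 + ∑' k, M.contProb T.ψ (k + 1) := by
    rw [tsum_eq_zero_add' ENNReal.summable, contProb_zero]
  rw [L, add_assoc, h1, M.K₀_eq T.ψ cost hψ, hcost, h2, add_assoc (c : ℝ≥0∞),
    ← add_assoc (M.rhoBar c lam 1), M.rhoBar_add_tsum_stopLoss c lam hψ, ENNReal.tsum_add,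
    ENNReal.tsum_mul_left]
  ring

variable {c lam}

/-- Without stopping losses the telescoped identity bounds c ∑ P₀(τ > k), over k ≥ 1, by ρ̄(1) ≤ λ;
a convergent series has terms tending to 0. -/
theorem mem_S₀_of_stopLoss_eq_zero (hc : 0 < c) {T : Test 𝔛}
    (h : ∀ k, M.stopLoss c lam T.ψ k = 0) : T ∈ M.S₀ := by
  refine (M.stopProb_eq_one_iff T.ψ).2 ?_
  have hsum : c * ∑' k, M.contProb T.ψ (k + 1) ≤ lam := by
    rw [← ENNReal.tsum_mul_left, ENNReal.tsum_eq_iSup_nat]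
    refine iSup_le fun N => ?_
    have hN := M.rhoBar_add_sum_stopLoss c lam T.ψ N
    simp only [h, Finset.sum_const_zero, add_zero] at hN
    refine le_trans ?_ (M.rhoBar_le c lam 1)
    rw [hN]
    exact le_add_right (Finset.sum_le_sum fun k _ => le_add_self)
  have hne : ∑' k, M.contProb T.ψ (k + 1) ≠ ∞ := fun htop => by
    rw [htop, ENNReal.mul_top (by simpa using hc.ne')] at hsum
    exact ENNReal.coe_ne_top (top_le_iff.1 hsum)
  exact (tendsto_add_atTop_iff_nat 1).1 (ENNReal.tendsto_atTop_zero_of_tsum_ne_top hne)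

/-! ### Vanishing losses and the RSPRT. -/

variable (c lam)

/-- `A` and `B` separate the likelihood ratios for which stopping is better from those for which
continuing is better. -/
structure IsBounds (A B : ℝ≥0) : Prop where
  lt_lam : A < lam
  lam_lt : lam < B
  eq_left : g lam A = c + M.rhoBar c lam A
  eq_right : g lam B = c + M.rhoBar c lam B
  outside : ∀ z : ℝ≥0, z < A ∨ B < z → g lam z < c + M.rhoBar c lam z
  inside : ∀ z : ℝ≥0, A < z → z < B → c + M.rhoBar c lam z < g lam z

variable {c lam} {A B : ℝ≥0}

variable {M}

theorem IsBounds.g_lt (hAB : M.IsBounds c lam A B) {z : ℝ≥0∞}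
    (hz : z ∉ Icc (A : ℝ≥0∞) B) : g lam z < c + M.rhoBar c lam z := by
  induction z with
  | top =>
    -- The bounds speak of finite ratios only; z = ∞ is compared with B + 1, where g already equals
    -- λ, by monotonicity of ρ̄.
    have h := hAB.outside (B + 1) (Or.inr (lt_add_one B))
    have hg : g lam ((B + 1 : ℝ≥0) : ℝ≥0∞) = lam :=
      min_eq_left (by exact_mod_cast hAB.lam_lt.le.trans (lt_add_one B).le)
    rw [hg] at h
    exact ((g_le lam ∞).trans_lt h).trans_le
      (add_le_add le_rfl (M.monotone_rhoBar c lam le_top))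
  | coe z =>
    refine hAB.outside z ?_
    by_contra! h
    exact hz ⟨by exact_mod_cast h.1, by exact_mod_cast h.2⟩

theorem IsBounds.lt_g (hAB : M.IsBounds c lam A B) {z : ℝ≥0∞}
    (hz : z ∈ Ioo (A : ℝ≥0∞) B) : c + M.rhoBar c lam z < g lam z := by
  lift z to ℝ≥0 using hz.2.ne_top
  exact hAB.inside z (by exact_mod_cast hz.1) (by exact_mod_cast hz.2)

/-- Inside (A, B) stopping is strictly worse, outside [A, B] continuing is; at A and B both cost the
same, so any randomization is free. -/
theorem IsBounds.stopDefect_eq_zero_iff (hAB : M.IsBounds c lam A B) {y z : ℝ≥0∞}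
    (hy : y ≤ 1) : M.stopDefect c lam y z = 0 ↔
      (Ioo (A : ℝ≥0∞) B).indicator 1 z ≤ 1 - y ∧ 1 - y ≤ (Icc (A : ℝ≥0∞) B).indicator 1 z := by
  have hsum : y + (1 - y) = 1 := add_tsub_cancel_of_le hy
  rw [stopDefect, tsub_eq_zero_iff_le, rho_eq_min]
  by_cases h1 : z ∈ Ioo (A : ℝ≥0∞) B
  · rw [min_eq_right (hAB.lt_g h1).le, weighted_mean_le_iff hsum (hAB.lt_g h1),
      indicator_of_mem h1, indicator_of_mem (Ioo_subset_Icc_self h1)]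
    exact ⟨by rintro rfl; simp, fun h => eq_zero_of_one_le_one_sub hy h.1⟩
  by_cases h2 : z ∈ Icc (A : ℝ≥0∞) B
  · have h3 : g lam z = c + M.rhoBar c lam z := by
      rcases eq_or_lt_of_le h2.1 with rfl | h
      · exact hAB.eq_left
      rcases eq_or_lt_of_le h2.2 with rfl | h'
      · exact hAB.eq_right
      exact absurd ⟨h, h'⟩ h1
    rw [indicator_of_notMem h1, indicator_of_mem h2, ← h3, min_self, ← add_mul, hsum, one_mul]
    simp
  · rw [min_eq_left (hAB.g_lt h2).le, add_comm,
      weighted_mean_le_iff (by rw [add_comm, hsum]) (hAB.g_lt h2),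
      indicator_of_notMem h1, indicator_of_notMem h2]
    simp

/-- The tie z = λ lies in (A, B) and is excluded, so the better terminal decision is unique:
rejection for z ≥ B, acceptance for z ≤ A. -/
theorem IsBounds.decisionDefect_eq_zero_iff (hAB : M.IsBounds c lam A B) {y z : ℝ≥0∞}
    (hy : y ≤ 1) (hz : z ∉ Ioo (A : ℝ≥0∞) B) :
    decisionDefect lam y z = 0 ↔ y = (Ici (B : ℝ≥0∞)).indicator 1 z := by
  have hsum : y + (1 - y) = 1 := add_tsub_cancel_of_le hy
  have hA : (A : ℝ≥0∞) < lam := by exact_mod_cast hAB.lt_lam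
  have hB : (lam : ℝ≥0∞) < B := by exact_mod_cast hAB.lam_lt
  rw [decisionDefect, tsub_eq_zero_iff_le, g]
  rcases le_or_gt (B : ℝ≥0∞) z with h | h
  · have hlz := hB.trans_le h
    rw [min_eq_left hlz.le, add_comm, weighted_mean_le_iff (by rw [add_comm, hsum]) hlz,
      indicator_of_mem (mem_Ici.2 h), tsub_eq_zero_iff_le, Pi.one_apply]
    exact ⟨fun h => le_antisymm hy h, fun h => h.ge⟩
  · have hzl : z < lam := lt_of_le_of_lt (not_lt.1 fun h' => hz ⟨h', h⟩) hA
    rw [min_eq_right hzl.le, weighted_mean_le_iff hsum hzl,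
      indicator_of_notMem (by simpa using h)]

theorem stopLoss_eq_zero_iff {ψ : Rule 𝔛} (hAB : M.IsBounds c lam A B) (k : ℕ) :
    M.stopLoss c lam ψ k = 0 ↔ ∀ n : Fin (k + 1) → ℕ, 0 < M.prob n →
      ∀ᵐ x ∂(M.law 0 n), 0 < ψ.t n x →
        (Ioo (A : ℝ≥0∞) B).indicator 1 (M.z x) ≤ 1 - ψ.val n x ∧
        1 - ψ.val n x ≤ (Icc (A : ℝ≥0∞) B).indicator 1 (M.z x) := by
  have hm (n : Fin (k + 1) → ℕ) :
      Measurable fun x => ψ.t n x * M.stopDefect c lam (ψ.val n x) (M.z x) :=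
    (ψ.measurable_t n).mul
      (M.measurable_stopDefect c lam (ψ.measurable_val n) (M.measurable_z n))
  rw [stopLoss, M.expect_eq_zero_iff hm]
  simp only [mul_eq_zero, or_iff_not_imp_left, hAB.stopDefect_eq_zero_iff (ψ.le_one _ _),
    pos_iff_ne_zero, ne_eq]

theorem decisionLoss_eq_zero_iff (T : Test 𝔛) (k : ℕ) :
    M.decisionLoss lam T k = 0 ↔ ∀ n : Fin (k + 1) → ℕ, 0 < M.prob n →
      (∀ᵐ x ∂(M.law 0 n), 0 < T.ψ.s n x → decisionDefect lam (T.φ.val n x) (M.z x) = 0) ∧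
      ∀ᵐ x ∂(M.law 1 n), x ∈ M.singularSet n → 0 < T.ψ.s n x → T.φ.val n x = 1 := by
  have h1 (n : Fin (k + 1) → ℕ) : Measurable fun x => T.ψ.s n x * (1 - T.φ.val n x) :=
    (T.ψ.measurable_s n).mul ((T.φ.measurable_val n).const_sub 1)
  have h2 (y : ℝ≥0∞) (hy : y ≤ 1) : 1 ≤ y ↔ y = 1 := ⟨fun h => le_antisymm hy h, fun h => h.ge⟩
  have hm (n : Fin (k + 1) → ℕ) :
      Measurable fun x => T.ψ.s n x * decisionDefect lam (T.φ.val n x) (M.z x) :=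
    (T.ψ.measurable_s n).mul
      (measurable_decisionDefect lam (T.φ.measurable_val n) (M.measurable_z n))
  rw [decisionLoss, add_eq_zero, M.expect_eq_zero_iff hm,
    M.expect_eq_zero_iff fun n => (h1 n).indicator (M.measurableSet_singularSet n),
    ← forall_and]
  simp only [← imp_and, indicator_apply_eq_zero, mul_eq_zero, or_iff_not_imp_left,
    pos_iff_ne_zero, ne_eq, tsub_eq_zero_iff_le, h2 _ (T.φ.le_one _ _)]

/-- The stopping condition keeps z_n out of (A, B) wherever s_n > 0, which makes the terminal
criterion applicable under P₀. Under P₁ only the singular set is new; there z_n = ∞ ≥ B, so both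
sides demand rejection. -/
theorem isRandomizedRSPRT_iff (hAB : M.IsBounds c lam A B) (T : Test 𝔛) :
    M.IsRandomizedRSPRT A B T ↔
      (∀ k, M.stopLoss c lam T.ψ k = 0) ∧ ∀ k, M.decisionLoss lam T k = 0 := by
  simp only [stopLoss_eq_zero_iff hAB, decisionLoss_eq_zero_iff, IsRandomizedRSPRT, ← forall_and]
  refine forall_congr' fun k => forall_congr' fun n => ?_
  refine imp_congr_right fun _ => and_congr_right fun hcont => ?_
  have hz : ∀ᵐ x ∂(M.law 0 n), 0 < T.ψ.s n x → M.z x ∉ Ioo (A : ℝ≥0∞) B := by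
    filter_upwards [hcont] with x hx hs hmem
    have hs' := hs.ne'
    rw [Rule.s, mul_ne_zero_iff] at hs'
    have h1 := (hx (pos_iff_ne_zero.2 hs'.1)).1
    rw [indicator_of_mem hmem, Pi.one_apply] at h1
    exact hs'.2 (eq_zero_of_one_le_one_sub (T.ψ.le_one n x) h1)
  have htop := M.ae_law_one_z_eq_top n
  have hBtop : (∞ : ℝ≥0∞) ∈ Ici (B : ℝ≥0∞) := mem_Ici.2 le_top
  constructor
  · intro h
    constructor
    · filter_upwards [h 0, hz] with x hx hxz hs
      exact (hAB.decisionDefect_eq_zero_iff (T.φ.le_one n x) (hxz hs)).2 (hx hs)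
    · filter_upwards [h 1, htop] with x hx hxt hsing hs
      rw [hx hs, hxt hsing, indicator_of_mem hBtop, Pi.one_apply]
  · rintro ⟨h0, h1⟩
    have hzero : ∀ᵐ x ∂(M.law 0 n), 0 < T.ψ.s n x →
        T.φ.val n x = (Ici (B : ℝ≥0∞)).indicator 1 (M.z x) := by
      filter_upwards [h0, hz] with x hx hxz hs
      exact (hAB.decisionDefect_eq_zero_iff (T.φ.le_one n x) (hxz hs)).1 (hx hs)
    refine Fin.forall_fin_two.2 ⟨hzero, M.ae_law_one_of_ae_law_zero hzero ?_⟩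
    filter_upwards [h1, htop] with x hx hxt hsing hs
    rw [hx hsing hs, hxt hsing, indicator_of_mem hBtop, Pi.one_apply]

theorem isRandomizedRSPRT_rsprt (A B : ℝ≥0) : M.IsRandomizedRSPRT A B (M.rsprt A B) := by
  refine fun k n _ => ⟨ae_of_all _ fun x _ => ?_, fun θ => ae_of_all _ fun x _ => rfl⟩
  have h : 1 - (M.rsprt A B).ψ.val n x = (Ioo (A : ℝ≥0∞) B).indicator 1 (M.z x) := by
    change 1 - (Ioo (A : ℝ≥0∞) B)ᶜ.indicator 1 (M.z x) = _
    by_cases hx : M.z x ∈ Ioo (A : ℝ≥0∞) B <;> simp [hx]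
  rw [h]
  exact ⟨le_rfl, indicator_le_indicator_of_subset Ioo_subset_Icc_self (fun _ => zero_le) _⟩

theorem IsBounds.L_eq_of_isRandomizedRSPRT (hAB : M.IsBounds c lam A B) (hc : 0 < c)
    {cost : ℕ → ℝ≥0} (hcost : M.avgCost cost = c) {T : Test 𝔛}
    (hT : M.IsRandomizedRSPRT A B T) :
    T ∈ M.S₀ ∧ M.L cost lam T = c + M.rhoBar c lam 1 := by
  obtain ⟨h1, h2⟩ := (isRandomizedRSPRT_iff hAB T).1 hT
  have hmem := M.mem_S₀_of_stopLoss_eq_zero hc h1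
  refine ⟨hmem, ?_⟩
  simp [M.L_eq c lam hcost hmem, h1, h2]

/-- The RSPRT attains the finite lower bound c + ρ̄(1), so after cancelling it a minimizer has total
loss 0. -/
theorem IsBounds.isLagrangeOptimal_iff (hAB : M.IsBounds c lam A B) (hc : 0 < c)
    {cost : ℕ → ℝ≥0} (hcost : M.avgCost cost = c) (T : Test 𝔛) :
    M.IsLagrangeOptimal cost lam T ↔ M.IsRandomizedRSPRT A B T := by
  constructor
  · rintro ⟨hT, hmin⟩
    obtain ⟨hmem, hL⟩ := hAB.L_eq_of_isRandomizedRSPRT hc hcost (isRandomizedRSPRT_rsprt A B)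
    have h := hmin _ hmem
    rw [hL, M.L_eq c lam hcost hT] at h
    have h0 := ENNReal.le_of_add_le_add_left (M.add_rhoBar_ne_top c lam 1)
      (h.trans_eq (add_zero _).symm)
    simp only [nonpos_iff_eq_zero, add_eq_zero, ENNReal.tsum_eq_zero] at h0
    exact (isRandomizedRSPRT_iff hAB T).2 h0
  · intro hT
    obtain ⟨hmem, hL⟩ := hAB.L_eq_of_isRandomizedRSPRT hc hcost hT
    refine ⟨hmem, fun T' hT' => ?_⟩
    rw [hL, M.L_eq c lam hcost hT']
    exact le_self_add

end Model

end GroupSeq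

/-! ### The conditional problem with bounded error probabilities. -/

namespace GroupSeq.Model

variable {𝔛 : Type*} [MeasurableSpace 𝔛] {M : Model 𝔛} {cost : ℕ → ℝ≥0} {lam : ℝ≥0}
  {T T' : Test 𝔛}

/-- The conditional problem: if `T` has the smaller Lagrangian and `T'` has no larger error
probabilities, then `T` is the cheaper test. -/
theorem K₀_le_of_L_le (hfin : M.L cost lam T ≠ ∞) (hL : M.L cost lam T ≤ M.L cost lam T')
    (hα : M.α T' ≤ M.α T) (hβ : M.β T' ≤ M.β T) : M.K₀ cost T.ψ ≤ M.K₀ cost T'.ψ := by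
  rw [L, add_assoc] at hfin hL
  rw [L, add_assoc] at hL
  exact ENNReal.le_of_add_le_add_right (ENNReal.add_ne_top.1 hfin).2
    (hL.trans (add_le_add le_rfl (add_le_add (mul_le_mul_right hα _) hβ)))

theorem K₀_lt_of_L_le (hlam : 0 < lam) (hfin : M.L cost lam T ≠ ∞)
    (hL : M.L cost lam T ≤ M.L cost lam T') (hα : M.α T' ≤ M.α T) (hβ : M.β T' ≤ M.β T)
    (h : M.α T' < M.α T ∨ M.β T' < M.β T) : M.K₀ cost T.ψ < M.K₀ cost T'.ψ := by
  by_contra! hK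
  have hle := mul_le_mul_right hα (lam : ℝ≥0∞)
  have hfin' : lam * M.α T + M.β T ≠ ∞ := by
    rw [L, add_assoc] at hfin
    exact (ENNReal.add_ne_top.1 hfin).2
  have hα' : lam * M.α T' ≠ ∞ := ne_top_of_le_ne_top (ENNReal.add_ne_top.1 hfin').1 hle
  have hβ' : M.β T' ≠ ∞ := ne_top_of_le_ne_top (ENNReal.add_ne_top.1 hfin').2 hβ
  -- Finite only thanks to the assumption made for contradiction; adding a strict inequality in
  -- `ℝ≥0∞` requires it.
  have hK' : M.K₀ cost T'.ψ ≠ ∞ := by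
    rw [L, add_assoc] at hfin
    exact ne_top_of_le_ne_top (ENNReal.add_ne_top.1 hfin).1 hK
  have herr : lam * M.α T' + M.β T' < lam * M.α T + M.β T := by
    rcases h with h | h
    · exact ENNReal.add_lt_add_of_lt_of_le hβ' (ENNReal.mul_lt_mul_right
        (by simpa using hlam.ne') ENNReal.coe_ne_top h) hβ
    · exact ENNReal.add_lt_add_of_le_of_lt hα' hle h
  refine hL.not_gt ?_
  rw [L, L, add_assoc, add_assoc]
  exact ENNReal.add_lt_add_of_le_of_lt hK' hK herr

end GroupSeq.Model

theorem mainTheorem7 {𝔛 : Type*} [MeasurableSpace 𝔛] (M : GroupSeq.Model 𝔛)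
    (hf : ∀ᵐ x ∂(M.P 0), 0 < M.f 1 x)
    (c lam : ℝ≥0) (hc : 0 < c) (hlam : 0 < lam)
    (hcl : (c : ℝ≥0∞) + M.rhoBar c lam lam < lam) :
    ∃ A B : ℝ≥0, 0 < A ∧ A < lam ∧ lam < B ∧
      GroupSeq.g lam A = c + M.rhoBar c lam A ∧
      GroupSeq.g lam B = c + M.rhoBar c lam B ∧
      (∀ z : ℝ≥0, z < A ∨ B < z → GroupSeq.g lam z < c + M.rhoBar c lam z) ∧
      (∀ z : ℝ≥0, A < z → z < B → c + M.rhoBar c lam z < GroupSeq.g lam z) ∧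
      ∀ cost : ℕ → ℝ≥0, M.avgCost cost = c →
        (∀ T : GroupSeq.Test 𝔛,
          M.IsLagrangeOptimal cost lam T ↔ M.IsRandomizedRSPRT A B T) ∧
        M.IsLagrangeOptimal cost lam (M.rsprt A B) ∧
        (∀ T : GroupSeq.Test 𝔛, M.IsRandomizedRSPRT A B T →
          ∀ T' ∈ M.S₀, M.α T' ≤ M.α T → M.β T' ≤ M.β T →
            M.K₀ cost T.ψ ≤ M.K₀ cost T'.ψ ∧
            (M.α T' < M.α T ∨ M.β T' < M.β T → M.K₀ cost T.ψ < M.K₀ cost T'.ψ) ∧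
            (M.K₀ cost T'.ψ = M.K₀ cost T.ψ → M.IsRandomizedRSPRT A B T')) := by
  obtain ⟨A, B, hA, hAl, hlB, hgA, hgB, hout, hin⟩ := M.exists_bounds c lam hf hc hlam hcl
  refine ⟨A, B, hA, hAl, hlB, hgA, hgB, hout, hin, fun cost hcost => ?_⟩
  have hAB : M.IsBounds c lam A B := ⟨hAl, hlB, hgA, hgB, hout, hin⟩
  have hopt := hAB.isLagrangeOptimal_iff hc hcost
  refine ⟨hopt, (hopt _).2 (GroupSeq.Model.isRandomizedRSPRT_rsprt A B),
    fun T hT T' hT' hα hβ => ?_⟩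
  have hmin := ((hopt T).2 hT).2
  have hfin : M.L cost lam T ≠ ∞ := by
    rw [(hAB.L_eq_of_isRandomizedRSPRT hc hcost hT).2]
    exact M.add_rhoBar_ne_top c lam 1
  refine ⟨GroupSeq.Model.K₀_le_of_L_le hfin (hmin T' hT') hα hβ,
    GroupSeq.Model.K₀_lt_of_L_le hlam hfin (hmin T' hT') hα hβ, fun hK => ?_⟩
  -- Equal cost and no larger errors give T' a Lagrangian no larger than that of T, so T' is itself
  -- a minimizer.
  refine (hopt T').1 ⟨hT', fun T'' hT'' => le_trans ?_ (hmin T'' hT'')⟩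
  exact add_le_add (add_le_add hK.le (mul_le_mul_right hα _)) hβ
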